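/- A \emph{rational polygon} is a set $P \subset \mathbb{R}^2$ that is the convex hull of finitely many points of $\mathbb{Q}^2$, not all contained in a line. By Ehrhart's theorem there are unique periodic functions $c_{P,0}, c_{P,1}, c_{P,2} \colon \mathbb{Z} \to \mathbb{Q}$ such that $$|nP \cap \mathbb{Z}^2| = c_{P,2}(n)\, n^2 + c_{P,1}(n)\, n + c_{P,0}(n) \quad \text{for all integers } n \ge 1,$$ where $nP = \{nx : x \in P\}$. The \emph{quasi-period} of $P$ is the least common multiple of the minimum periods of $c_{P,0}, c_{P,1}, c_{P,2}$, and $P$ is a \emph{pseudo-integral polygon} (PIP) if its quasi-period is $1$, i.e. if its Ehrhart quasi-polynomial is a polynomial. Let $I_P$ and $b_P$ denote the numbers of points of $\mathbb{Z}^2$ in the interior and on the boundary of $P$, respectively. \textbf{Theorem.} There does not exist a PIP $P$ with $b_P = 0$ or with $(I_P, b_P) \in \{(0,1), (0,2)\}$. However, for all integers $I \ge 1$ and $b \in \{1, 2\}$, there exists a PIP $P$ with $(I_P, b_P) = (I, b)$. -/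

import Mathlib

namespace EhrhartPIP

/-- The point of the plane with the given rational coordinates. -/
def ratPoint (q : ℚ × ℚ) : ℝ × ℝ := ((q.1 : ℝ), (q.2 : ℝ))

/-- The integer lattice `ℤ²` inside the plane. -/
def lattice : Set (ℝ × ℝ) := Set.range fun z : ℤ × ℤ => ((z.1 : ℝ), (z.2 : ℝ))

/-- A rational polygon: the convex hull of finitely many rational points, not all contained in a
line. -/
def IsRationalPolygon (P : Set (ℝ × ℝ)) : Prop :=
  ∃ S : Finset (ℚ × ℚ),
    ¬ Collinear ℝ (ratPoint '' (S : Set (ℚ × ℚ))) ∧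
      P = convexHull ℝ (ratPoint '' (S : Set (ℚ × ℚ)))

/-- The dilation `nP = {n x : x ∈ P}`. -/
def dilate (n : ℕ) (P : Set (ℝ × ℝ)) : Set (ℝ × ℝ) := (fun x => (n : ℝ) • x) '' P

/-- The number of lattice points in a bounded set. -/
noncomputable def latticeCount (P : Set (ℝ × ℝ)) : ℕ := (P ∩ lattice).ncard

/-- The number of lattice points in the interior of `P`. -/
noncomputable def interiorCount (P : Set (ℝ × ℝ)) : ℕ := latticeCount (interior P)

/-- The number of lattice points on the boundary of `P`. -/
noncomputable def boundaryCount (P : Set (ℝ × ℝ)) : ℕ := latticeCount (frontier P)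

/-- The functions `c 0, c 1, c 2 : ℤ → ℚ` are the coefficient functions of the Ehrhart
quasi-polynomial of `P`: they are periodic, and the number of lattice points in `nP` is
`c 2 n * n ^ 2 + c 1 n * n + c 0 n` for all positive integers `n`.
For a given `P` at most one such `c` exists, see `IsEhrhartCoeff.unique`. -/
structure IsEhrhartCoeff (P : Set (ℝ × ℝ)) (c : Fin 3 → ℤ → ℚ) : Prop where
  periodic : ∀ i, ∃ s : ℕ, 0 < s ∧ Function.Periodic (c i) (s : ℤ)
  count : ∀ n : ℕ, 0 < n →
    (latticeCount (dilate n P) : ℚ) = c 2 n * (n : ℚ) ^ 2 + c 1 n * (n : ℚ) + c 0 n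

/-- The minimum (positive) period of a periodic function on the integers. -/
noncomputable def minPeriod (f : ℤ → ℚ) : ℕ :=
  sInf {s : ℕ | 0 < s ∧ Function.Periodic f (s : ℤ)}

/-- The quasi-period: the least common multiple of the minimum periods of the coefficients. -/
noncomputable def quasiPeriod (c : Fin 3 → ℤ → ℚ) : ℕ :=
  Nat.lcm (Nat.lcm (minPeriod (c 0)) (minPeriod (c 1))) (minPeriod (c 2))

/-- A pseudo-integral polygon: a rational polygon whose Ehrhart quasi-polynomial has
quasi-period 1. -/
def IsPIP (P : Set (ℝ × ℝ)) : Prop :=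
  IsRationalPolygon P ∧ ∃ c, IsEhrhartCoeff P c ∧ quasiPeriod c = 1

/-- The coefficient functions of the Ehrhart quasi-polynomial are unique. -/
theorem IsEhrhartCoeff.unique {P : Set (ℝ × ℝ)} {c d : Fin 3 → ℤ → ℚ}
    (hc : IsEhrhartCoeff P c) (hd : IsEhrhartCoeff P d) : c = d := by
  choose s hs hsp using hc.periodic
  choose t ht htp using hd.periodic
  set N : ℕ := (∏ i, s i) * ∏ i, t i with hN
  have hNpos : 0 < N :=
    Nat.mul_pos (Finset.prod_pos fun i _ => hs i) (Finset.prod_pos fun i _ => ht i)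
  have key : ∀ (f : ℤ → ℚ) (p : ℕ), Function.Periodic f (p : ℤ) → p ∣ N →
      ∀ (x : ℤ) (k : ℕ), f (x + k * N) = f x := by
    rintro f p hf ⟨q, hq⟩ x k
    have h := hf.int_mul ((k : ℤ) * q) x
    rw [hq]
    push_cast
    rw [← h]
    congr 1
    push_cast
    ring
  have hcs : ∀ i (x : ℤ) (k : ℕ), c i (x + k * N) = c i x := fun i =>
    key _ _ (hsp i) ((Finset.dvd_prod_of_mem s (Finset.mem_univ i)).trans (Dvd.intro _ rfl))
  have hdt : ∀ i (x : ℤ) (k : ℕ), d i (x + k * N) = d i x := fun i =>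
    key _ _ (htp i) ((Finset.dvd_prod_of_mem t (Finset.mem_univ i)).trans (Dvd.intro_left _ rfl))
  have main : ∀ x : ℤ, c 0 x = d 0 x ∧ c 1 x = d 1 x ∧ c 2 x = d 2 x := by
    intro x
    have hval : ∀ j : ℕ, 0 < j → ∃ y : ℚ, y = x + (x.natAbs + j : ℕ) * N ∧
        c 2 x * y ^ 2 + c 1 x * y + c 0 x = d 2 x * y ^ 2 + d 1 x * y + d 0 x := by
      intro j hj
      refine ⟨_, rfl, ?_⟩
      have hpos : 0 < x + ((x.natAbs + j : ℕ) : ℤ) * N := by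
        have h1 : (1 : ℤ) ≤ N := by exact_mod_cast hNpos
        have h2 : (0 : ℤ) < x + (x.natAbs + j : ℕ) := by omega
        nlinarith [Int.natCast_nonneg (x.natAbs + j)]
      obtain ⟨n, hn⟩ := Int.eq_ofNat_of_zero_le hpos.le
      have hn0 : 0 < n := by omega
      have e := (hc.count n hn0).symm.trans (hd.count n hn0)
      rw [show ((n : ℕ) : ℤ) = x + ((x.natAbs + j : ℕ) : ℤ) * N from hn.symm] at e
      simp only [hcs, hdt] at e
      have hq : (n : ℚ) = x + (x.natAbs + j : ℕ) * N := by
        have h := congrArg (Int.cast : ℤ → ℚ) hn.symm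
        simpa only [Int.cast_add, Int.cast_mul, Int.cast_natCast] using h
      rw [hq] at e
      exact e
    obtain ⟨y1, e1, h1⟩ := hval 1 (by norm_num)
    obtain ⟨y2, e2, h2⟩ := hval 2 (by norm_num)
    obtain ⟨y3, e3, h3⟩ := hval 3 (by norm_num)
    have hNq : (N : ℚ) ≠ 0 := by exact_mod_cast hNpos.ne'
    have f2 : y2 = y1 + N := by rw [e1, e2]; push_cast; ring
    have f3 : y3 = y1 + 2 * N := by rw [e1, e3]; push_cast; ring
    rw [f2] at h2
    rw [f3] at h3
    have g2 : c 2 x = d 2 x := by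
      have : (c 2 x - d 2 x) * (2 * (N : ℚ) ^ 2) = 0 := by linear_combination h3 - 2 * h2 + h1
      have := (mul_eq_zero.mp this).resolve_right (by positivity)
      linarith
    have g1 : c 1 x = d 1 x := by
      rw [g2] at h1 h2
      have : (c 1 x - d 1 x) * (N : ℚ) = 0 := by linear_combination h2 - h1
      have := (mul_eq_zero.mp this).resolve_right hNq
      linarith
    refine ⟨?_, g1, g2⟩
    rw [g2, g1] at h1
    linarith
  funext i x
  fin_cases i
  · exact (main x).1
  · exact (main x).2.1
  · exact (main x).2.2

end EhrhartPIP

namespace EhrhartPIP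

/-! Nonexistence rests on Ehrhart's theorem with Ehrhart–Macdonald reciprocity
(`exists_ehrhart_reciprocity`): some quasi-quadratic `E` has `E 0 = 1` and counts the lattice points
of `nP` at `n > 0` and those of its interior at `-n`. If `P` is a PIP, then `E n = a n² + b n + 1`
for all integers `n`, so `b_P = 2 b` and the interior of `nP` contains `a n² - b n + 1` lattice
points. Here `b ≠ 0`, because some dilate of `P` has a lattice point on its boundary. If `I_P = 0`,
then `a = b - 1`, and the interior of `3P` contains `6 b - 8 ≥ 0` points, so `b_P > 2`.

Reciprocity is proved column by column. Let `g` be the top of `P` and `f` minus its bottom, as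
functions of the first coordinate. Column `x` of `nP` contains `⌊n g(x/n)⌋ + ⌊n f(x/n)⌋ + 1` lattice
points. Since `⌊-t⌋ = -⌈t⌉`, the same expression at `-n`, `-x` is minus the number of points in
column `x` of the interior. As `f` and `g` are piecewise linear with rational data, summing over
columns gives a quasi-quadratic function valid for both signs of `n`.

Existence uses kites with vertices `(1, 0)`, `(-K/L, 0)`, `(0, 1/q)`, `(0, -K/q)`, where `K = q J +
1`. Their interior lattice points are `(0, -J), …, (0, 0)`. The choice `q = 3`, `L = K + 1` gives
one boundary point, and `q = 2`, `L = K` gives two. Counting by rows, the growth from `nP` to `(n +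
q)P` is a sum of floors that Hermite's identity evaluates without remainder, which makes the count a
polynomial (`kiteCount_three`, `kiteCount_two`). -/

/-! ### Quasi-quadratic functions and sums of floors. -/

/-- A function on the integers whose restriction to each residue class of some modulus is a
polynomial of degree at most two. -/
def IsQuasiQuadratic (E : ℤ → ℚ) : Prop :=
  ∃ D : ℤ, 0 < D ∧ ∀ n, ∃ a b c : ℚ, ∀ j : ℤ, E (n + j * D) = a * j ^ 2 + b * j + c

theorem IsQuasiQuadratic.add {E F : ℤ → ℚ} (hE : IsQuasiQuadratic E) (hF : IsQuasiQuadratic F) :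
    IsQuasiQuadratic fun n => E n + F n := by
  obtain ⟨D, hD, hE⟩ := hE
  obtain ⟨D', hD', hF⟩ := hF
  refine ⟨D * D', mul_pos hD hD', fun n => ?_⟩
  obtain ⟨a, b, c, h⟩ := hE n
  obtain ⟨a', b', c', h'⟩ := hF n
  refine ⟨a * D' ^ 2 + a' * D ^ 2, b * D' + b' * D, c + c', fun j => ?_⟩
  have e := h (j * D')
  have e' := h' (j * D)
  rw [show n + j * D' * D = n + j * (D * D') by ring] at e
  rw [show n + j * D * D' = n + j * (D * D') by ring] at e'
  simp only [e, e']
  push_cast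
  ring

theorem IsQuasiQuadratic.neg {E : ℤ → ℚ} (hE : IsQuasiQuadratic E) :
    IsQuasiQuadratic fun n => - E n := by
  obtain ⟨D, hD, hE⟩ := hE
  refine ⟨D, hD, fun n => ?_⟩
  obtain ⟨a, b, c, h⟩ := hE n
  exact ⟨-a, -b, -c, fun j => by dsimp only; rw [h]; ring⟩

theorem IsQuasiQuadratic.sub {E F : ℤ → ℚ} (hE : IsQuasiQuadratic E) (hF : IsQuasiQuadratic F) :
    IsQuasiQuadratic fun n => E n - F n := by
  simpa only [sub_eq_add_neg] using hE.add hF.neg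

/-- A quasi-quadratic function that agrees with a quadratic polynomial at all positive integers
agrees with it everywhere. -/
theorem IsQuasiQuadratic.eq_of_forall_pos {E : ℤ → ℚ} (hE : IsQuasiQuadratic E) {a b c : ℚ}
    (h : ∀ n : ℤ, 0 < n → E n = a * n ^ 2 + b * n + c) (n : ℤ) : E n = a * n ^ 2 + b * n + c := by
  obtain ⟨D, hD, hE⟩ := hE
  obtain ⟨a', b', c', h'⟩ := hE n
  -- For `j > |n|` the argument `n + j D` is positive. Three such `j` determine a quadratic in `j`,
  -- whose value at `j = 0` is the one wanted.
  have key : ∀ j : ℤ, |n| < j → a' * j ^ 2 + b' * j + c'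
      = a * (n + j * D : ℤ) ^ 2 + b * (n + j * D : ℤ) + c := by
    intro j hj
    rw [← h', h]
    have := neg_abs_le n
    nlinarith [abs_nonneg n]
  have h1 := key (|n| + 1) (by linarith)
  have h2 := key (|n| + 2) (by linarith)
  have h3 := key (|n| + 3) (by linarith)
  have h0 := h' 0
  simp only [zero_mul, add_zero, Int.cast_zero] at h0
  rw [h0]
  push_cast at h1 h2 h3
  set t : ℚ := |(n : ℚ)|
  have ha : a' = a * D ^ 2 := by linear_combination (h1 - 2 * h2 + h3) / 2
  subst ha
  have hb : b' = 2 * a * n * D + b * D := by linear_combination h2 - h1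
  subst hb
  linear_combination h1

theorem eq_of_forall_step {G : ℤ → ℚ} {a b : ℚ} (h : ∀ j, G (j + 1) = G j + a + b * j) (j : ℤ) :
    G j = G 0 + a * j + b * (j * (j - 1) / 2) := by
  induction j using Int.induction_on with
  | zero => simp
  | succ i ih => rw [h, ih]; push_cast; ring
  | pred i ih =>
    have := h (-i - 1)
    rw [sub_add_cancel, ih] at this
    push_cast at this ⊢
    linear_combination -this

/-- The sum of `h` over `(0, N]`, with the usual sign convention if `N` is negative. -/
noncomputable def intSum (h : ℤ → ℚ) (N : ℤ) : ℚ := ∑ x ∈ Finset.Ioc 0 N, h x - ∑ x ∈ Finset.Ioc N 0, h x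

@[simp] theorem intSum_zero (h : ℤ → ℚ) : intSum h 0 = 0 := by simp [intSum]

theorem intSum_add_one (h : ℤ → ℚ) (N : ℤ) : intSum h (N + 1) = intSum h N + h (N + 1) := by
  unfold intSum
  rcases lt_or_ge N 0 with hN | hN
  · rw [Finset.Ioc_eq_empty (by omega), Finset.Ioc_eq_empty (by omega : ¬ 0 < N)]
    have : Finset.Ioc N 0 = insert (N + 1) (Finset.Ioc (N + 1) 0) := by ext; simp; omega
    rw [this, Finset.sum_insert (by simp)]
    ring
  · rw [Finset.Ioc_eq_empty (by omega : ¬ N < 0), Finset.Ioc_eq_empty (by omega : ¬ N + 1 < 0)]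
    have : Finset.Ioc 0 (N + 1) = insert (N + 1) (Finset.Ioc 0 N) := by ext; simp; omega
    rw [this, Finset.sum_insert (by simp)]
    ring

theorem intSum_sub_intSum (h : ℤ → ℚ) {M N : ℤ} (hMN : M ≤ N) :
    intSum h N - intSum h M = ∑ x ∈ Finset.Ioc M N, h x := by
  induction N, hMN using Int.leInduction with
  | base => simp
  | succ N hN ih =>
    have : Finset.Ioc M (N + 1) = insert (N + 1) (Finset.Ioc M N) := by ext; simp; omega
    rw [this, Finset.sum_insert (by simp), ← ih, intSum_add_one]
    ring

theorem intSum_add_const (h : ℤ → ℚ) (a : ℚ) (N : ℤ) :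
    intSum (fun x => h x + a) N = intSum h N + a * N := by
  have := eq_of_forall_step (G := fun N => intSum (fun x => h x + a) N - intSum h N) (a := a)
    (b := 0) (fun j => by simp only [intSum_add_one]; ring) N
  simp only [intSum_zero] at this
  linear_combination this

/-- Summing a family that is affine along residue classes up to a bound that is affine along
residue classes gives a quasi-quadratic function. -/
theorem isQuasiQuadratic_intSum {h : ℤ → ℤ → ℚ} {L : ℤ → ℤ} {D K : ℤ} {a b : ℚ} (hD : 0 < D)
    (h1 : ∀ n x, h (n + D) x = h n x + a) (h2 : ∀ n x, h n (x + K) = h n x + b)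
    (hL : ∀ n, L (n + D) = L n + K) : IsQuasiQuadratic fun n => intSum (h n) (L n) := by
  refine ⟨D, hD, fun n => ?_⟩
  have hh : ∀ j : ℤ, h (n + j * D) = fun x => h n x + a * j := by
    intro j
    funext x
    have := eq_of_forall_step (G := fun j => h (n + j * D) x) (a := a) (b := 0)
      (fun j => by rw [← add_zero (_ + a), show n + (j + 1) * D = n + j * D + D by ring, h1]; ring) j
    simpa using this
  have hLj : ∀ j : ℤ, L (n + j * D) = L n + j * K := by
    intro j
    have := eq_of_forall_step (G := fun j => (L (n + j * D) : ℚ)) (a := K) (b := 0)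
      (fun j => by rw [show n + (j + 1) * D = n + j * D + D by ring, hL]; push_cast; ring) j
    simp only [zero_mul, add_zero] at this
    have h' : (L (n + j * D) : ℚ) = (L n + j * K : ℤ) := by push_cast; linear_combination this
    exact_mod_cast h'
  -- Moving a window of length `K` one step changes its sum by the constant `b`, so window sums are
  -- affine in the position. Sums up to `L n + j K` then have differences affine in `j`, hence are
  -- quadratic in `j`.
  have hW : ∀ y : ℤ, intSum (h n) (y + K) - intSum (h n) y = intSum (h n) K + b * y := by
    intro y
    have := eq_of_forall_step (G := fun y => intSum (h n) (y + K) - intSum (h n) y) (a := b)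
      (b := 0) (fun j => by
        rw [show j + 1 + K = j + K + 1 by ring, intSum_add_one, intSum_add_one,
          show j + K + 1 = j + 1 + K by ring, h2]; ring) y
    simpa using this
  have hF : ∀ j : ℤ, intSum (h n) (L n + j * K) = intSum (h n) (L n)
      + (intSum (h n) K + b * L n) * j + b * K * (j * (j - 1) / 2) := by
    intro j
    have := eq_of_forall_step (G := fun j => intSum (h n) (L n + j * K))
      (a := intSum (h n) K + b * L n) (b := b * K) (fun j => by
        have := hW (L n + j * K)
        rw [show L n + (j + 1) * K = L n + j * K + K by ring]
        push_cast at this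
        linear_combination this) j
    simpa using this
  refine ⟨b * K / 2 + a * K, intSum (h n) K + b * L n - b * K / 2 + a * L n,
    intSum (h n) (L n), fun j => ?_⟩
  simp only [hh, hLj, intSum_add_const, hF]
  push_cast
  ring

theorem isQuasiQuadratic_intSum_floor (m c v : ℚ) :
    IsQuasiQuadratic fun n => intSum (fun x => (⌊m * x + n * c⌋ : ℚ)) ⌊(n : ℚ) * v⌋ := by
  have hm : m * m.den = m.num := Rat.mul_den_eq_num m
  have hc : c * c.den = c.num := Rat.mul_den_eq_num c
  have hv : v * v.den = v.num := Rat.mul_den_eq_num v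
  refine isQuasiQuadratic_intSum (h := fun n x => (⌊m * x + n * c⌋ : ℚ))
    -- `D` clears the denominators of `c` and `v`, so `n c` and `n v` grow by integers. The
    -- resulting shift `K` of the bound is a multiple of `m.den`, so `m x` also grows by an integer
    -- under `x ↦ x + K`.
    (D := m.den * c.den * v.den) (K := m.den * c.den * v.num)
    (a := (m.den * v.den * c.num : ℤ)) (b := (m.num * c.den * v.num : ℤ)) ?_ ?_ ?_ ?_
  · have := m.den_pos; have := c.den_pos; have := v.den_pos; positivity
  · intro n x
    rw [← Int.cast_add, ← Int.floor_add_intCast]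
    congr 2
    push_cast
    linear_combination (m.den * v.den : ℚ) * hc
  · intro n x
    rw [← Int.cast_add, ← Int.floor_add_intCast]
    congr 2
    push_cast
    linear_combination (c.den * v.num : ℚ) * hm
  · intro n
    rw [← Int.floor_add_intCast]
    congr 1
    push_cast
    linear_combination (m.den * c.den : ℚ) * hv

theorem isQuasiQuadratic_floor (v : ℚ) : IsQuasiQuadratic fun n => (⌊(n : ℚ) * v⌋ : ℚ) := by
  have hv : v * v.den = v.num := Rat.mul_den_eq_num v
  refine ⟨v.den, by exact_mod_cast v.den_pos, fun n => ⟨0, v.num, ⌊(n : ℚ) * v⌋, fun j => ?_⟩⟩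
  have : ((n + j * v.den : ℤ) : ℚ) * v = n * v + (j * v.num : ℤ) := by
    push_cast; linear_combination (j : ℚ) * hv
  dsimp only
  rw [this, Int.floor_add_intCast]
  push_cast
  ring

/-- The signed sum of `⌊m x + n c⌋ + ⌊m' x + n c'⌋ + 1` over the integers `x` in `(n u, n v]` is
quasi-quadratic in `n`. -/
theorem exists_isQuasiQuadratic_sum (m c m' c' : ℚ) {u v : ℚ} (huv : u ≤ v) :
    ∃ T : ℤ → ℚ, IsQuasiQuadratic T ∧ T 0 = 0 ∧
      (∀ n : ℤ, 0 < n → T n = ∑ x ∈ Finset.Ioc ⌊(n : ℚ) * u⌋ ⌊(n : ℚ) * v⌋,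
        ((⌊m * x + n * c⌋ + ⌊m' * x + n * c'⌋ + 1 : ℤ) : ℚ)) ∧
      (∀ n : ℤ, n < 0 → T n = - ∑ x ∈ Finset.Ioc ⌊(n : ℚ) * v⌋ ⌊(n : ℚ) * u⌋,
        ((⌊m * x + n * c⌋ + ⌊m' * x + n * c'⌋ + 1 : ℤ) : ℚ)) := by
  have hcast : ∀ (s : Finset ℤ) (n : ℤ),
      ∑ x ∈ s, ((⌊m * x + n * c⌋ + ⌊m' * x + n * c'⌋ + 1 : ℤ) : ℚ)
        = ∑ x ∈ s, (⌊m * x + n * c⌋ : ℚ) + ∑ x ∈ s, (⌊m' * x + n * c'⌋ : ℚ)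
          + ∑ x ∈ s, (0 + 1 : ℚ) := by
    intro s n
    push_cast
    simp only [Finset.sum_add_distrib, zero_add]
  -- The summand `1` is written `0 + 1` to match `intSum_add_const`.
  have hone : ∀ N : ℤ, (N : ℚ) = intSum (fun _ => 0 + 1) N := by
    intro N
    rw [intSum_add_const]
    simp [intSum]
  refine ⟨fun n => ((intSum (fun x => (⌊m * x + n * c⌋ : ℚ)) ⌊(n : ℚ) * v⌋
        - intSum (fun x => (⌊m * x + n * c⌋ : ℚ)) ⌊(n : ℚ) * u⌋)
      + (intSum (fun x => (⌊m' * x + n * c'⌋ : ℚ)) ⌊(n : ℚ) * v⌋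
        - intSum (fun x => (⌊m' * x + n * c'⌋ : ℚ)) ⌊(n : ℚ) * u⌋))
      + ((⌊(n : ℚ) * v⌋ : ℚ) - (⌊(n : ℚ) * u⌋ : ℚ)), ?_, ?_, ?_, ?_⟩
  · exact (((isQuasiQuadratic_intSum_floor m c v).sub (isQuasiQuadratic_intSum_floor m c u)).add
      ((isQuasiQuadratic_intSum_floor m' c' v).sub (isQuasiQuadratic_intSum_floor m' c' u))).add
      ((isQuasiQuadratic_floor v).sub (isQuasiQuadratic_floor u))
  · simp
  · intro n hn
    have hn' : (0 : ℚ) < n := by exact_mod_cast hn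
    have hle : ⌊(n : ℚ) * u⌋ ≤ ⌊(n : ℚ) * v⌋ := Int.floor_le_floor (by gcongr)
    rw [hcast, ← intSum_sub_intSum _ hle, ← intSum_sub_intSum _ hle, ← intSum_sub_intSum _ hle,
      ← hone, ← hone]
  · intro n hn
    have hn' : (n : ℚ) < 0 := by exact_mod_cast hn
    have hle : ⌊(n : ℚ) * v⌋ ≤ ⌊(n : ℚ) * u⌋ :=
      Int.floor_le_floor (mul_le_mul_of_nonpos_left huv hn'.le)
    rw [hcast, ← intSum_sub_intSum _ hle, ← intSum_sub_intSum _ hle, ← intSum_sub_intSum _ hle,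
      ← hone, ← hone]
    ring

/-- This is the contribution of the leftmost column, which the half-open range `(n u, n v]` misses.
It is present only when `n a` is an integer, a condition periodic in `n`. -/
theorem isQuasiQuadratic_column (a s t : ℚ) : IsQuasiQuadratic fun n =>
    if (⌊(n : ℚ) * a⌋ : ℚ) = n * a then ((⌊(n : ℚ) * s⌋ + ⌊(n : ℚ) * t⌋ + 1 : ℤ) : ℚ) else 0 := by
  have ha : a * a.den = a.num := Rat.mul_den_eq_num a
  have hs : s * s.den = s.num := Rat.mul_den_eq_num s
  have ht : t * t.den = t.num := Rat.mul_den_eq_num t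
  refine ⟨a.den * s.den * t.den, ?_, fun n => ?_⟩
  · have := a.den_pos; have := s.den_pos; have := t.den_pos; positivity
  have ea : ∀ j : ℤ, ((n + j * (a.den * s.den * t.den) : ℤ) : ℚ) * a
      = n * a + (j * s.den * t.den * a.num : ℤ) := by
    intro j; push_cast; linear_combination (j * s.den * t.den : ℚ) * ha
  have es : ∀ j : ℤ, ((n + j * (a.den * s.den * t.den) : ℤ) : ℚ) * s
      = n * s + (j * a.den * t.den * s.num : ℤ) := by
    intro j; push_cast; linear_combination (j * a.den * t.den : ℚ) * hs
  have et : ∀ j : ℤ, ((n + j * (a.den * s.den * t.den) : ℤ) : ℚ) * t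
      = n * t + (j * a.den * s.den * t.num : ℤ) := by
    intro j; push_cast; linear_combination (j * a.den * s.den : ℚ) * ht
  by_cases h : (⌊(n : ℚ) * a⌋ : ℚ) = n * a
  · refine ⟨0, a.den * t.den * s.num + a.den * s.den * t.num,
      ⌊(n : ℚ) * s⌋ + ⌊(n : ℚ) * t⌋ + 1, fun j => ?_⟩
    simp only [ea, es, et, Int.floor_add_intCast]
    rw [if_pos (by push_cast; rw [h])]
    push_cast
    ring
  · refine ⟨0, 0, 0, fun j => ?_⟩
    simp only [ea, Int.floor_add_intCast]
    rw [if_neg (by push_cast; simpa using h)]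
    simp

/-! ### Upper and lower boundary of a rational polygon. -/

/-- The convex hull of finitely many rational points. -/
def hull (S : Finset (ℚ × ℚ)) : Set (ℝ × ℝ) := convexHull ℝ (ratPoint '' (S : Set (ℚ × ℚ)))

/-- For `σ = 1` the top of the column of `P` above `x`, for `σ = -1` minus its bottom. -/
noncomputable def columnSup (P : Set (ℝ × ℝ)) (σ x : ℝ) : ℝ := sSup {y | (x, σ * y) ∈ P}

theorem ratPoint_mem_hull {S : Finset (ℚ × ℚ)} {p : ℚ × ℚ} (hp : p ∈ S) : ratPoint p ∈ hull S :=
  subset_convexHull ℝ _ ⟨p, hp, rfl⟩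

theorem convex_hull (S : Finset (ℚ × ℚ)) : Convex ℝ (hull S) := convex_convexHull ℝ _

theorem isCompact_hull (S : Finset (ℚ × ℚ)) : IsCompact (hull S) :=
  (S.finite_toSet.image _).isCompact_convexHull ℝ

theorem hull_subset_halfPlane {S : Finset (ℚ × ℚ)} {α β γ : ℝ}
    (h : ∀ p ∈ S, α * p.1 + β * p.2 ≤ γ) {z : ℝ × ℝ} (hz : z ∈ hull S) :
    α * z.1 + β * z.2 ≤ γ := by
  have hconv : Convex ℝ {z : ℝ × ℝ | α * z.1 + β * z.2 ≤ γ} := by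
    intro z hz w hw s t hs ht hst
    simp only [Set.mem_ofPred_eq, Prod.fst_add, Prod.snd_add, Prod.smul_fst, Prod.smul_snd,
      smul_eq_mul] at *
    have : γ = s * γ + t * γ := by rw [← add_mul, hst, one_mul]
    nlinarith [mul_le_mul_of_nonneg_left hz hs, mul_le_mul_of_nonneg_left hw ht]
  refine convexHull_min ?_ hconv hz
  rintro _ ⟨p, hp, rfl⟩
  exact h p hp

/-- The boundary of the hull is linear over an interval containing no first coordinate of a
generator in its interior. -/
theorem exists_line {S : Finset (ℚ × ℚ)} {σ u v : ℚ} (hσ : σ * σ = 1) (huv : u < v)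
    (hgap : ∀ p ∈ S, p.1 ≤ u ∨ v ≤ p.1) (hl : ∃ p ∈ S, p.1 ≤ u) (hr : ∃ p ∈ S, v ≤ p.1) :
    ∃ m c : ℚ, ∀ x : ℝ, u ≤ x → x ≤ v → (x, (σ : ℝ) * (m * x + c)) ∈ hull S ∧
      ∀ y, (x, y) ∈ hull S → σ * y ≤ m * x + c := by
  -- The edge over the gap is the chord, from a generator on the left to one on the right, that is
  -- highest above the midpoint `w`. Its height there, after multiplying second coordinates by `σ`,
  -- is `I`.
  set w : ℚ := (u + v) / 2 with hw
  have huw : u < w := by linarith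
  have hwv : w < v := by linarith
  let I : (ℚ × ℚ) × (ℚ × ℚ) → ℚ := fun pq =>
    (σ * pq.1.2 * (pq.2.1 - w) + σ * pq.2.2 * (w - pq.1.1)) / (pq.2.1 - pq.1.1)
  obtain ⟨p₀, hp₀, hp₀'⟩ := hl
  obtain ⟨q₀, hq₀, hq₀'⟩ := hr
  obtain ⟨⟨p, q⟩, hpq, hmax⟩ := Finset.exists_max_image
    (S.filter (fun p => p.1 ≤ u) ×ˢ S.filter (fun p => v ≤ p.1)) I
    ⟨(p₀, q₀), by simp [hp₀, hq₀, hp₀', hq₀']⟩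
  simp only [Finset.mem_product, Finset.mem_filter] at hpq hmax
  obtain ⟨⟨hp, hpu⟩, hq, hqv⟩ := hpq
  have hd : 0 < q.1 - p.1 := by linarith
  set m : ℚ := (σ * q.2 - σ * p.2) / (q.1 - p.1) with hm
  set c : ℚ := σ * p.2 - m * p.1 with hc
  have hmd : m * (q.1 - p.1) = σ * q.2 - σ * p.2 := div_mul_cancel₀ _ hd.ne'
  have ep : σ * p.2 = m * p.1 + c := by rw [hc]; ring
  have eq : σ * q.2 = m * q.1 + c := by rw [hc]; linear_combination -hmd
  have hI : I (p, q) = m * w + c := by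
    simp only [I]
    rw [div_eq_iff hd.ne', ep, eq]
    ring
  -- A generator above the line could replace the endpoint on its own side and raise the chord at
  -- `w`.
  have hbelow : ∀ r ∈ S, σ * r.2 ≤ m * r.1 + c := by
    intro r hr
    rcases hgap r hr with h | h
    · have := hmax (r, q) ⟨⟨hr, h⟩, hq, hqv⟩
      rw [hI] at this
      simp only [I] at this
      rw [div_le_iff₀ (by linarith), eq] at this
      have h2 : σ * r.2 * (q.1 - w) ≤ (m * r.1 + c) * (q.1 - w) := by linarith
      exact le_of_mul_le_mul_right h2 (by linarith)
    · have := hmax (p, r) ⟨⟨hp, hpu⟩, hr, h⟩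
      rw [hI] at this
      simp only [I] at this
      rw [div_le_iff₀ (by linarith), ep] at this
      have h2 : σ * r.2 * (w - p.1) ≤ (m * r.1 + c) * (w - p.1) := by linarith
      exact le_of_mul_le_mul_right h2 (by linarith)
  refine ⟨m, c, fun x hux hxv => ⟨?_, fun y hy => ?_⟩⟩
  · have hd' : (0 : ℝ) < q.1 - p.1 := by exact_mod_cast hd
    have hpu' : (p.1 : ℝ) ≤ u := by exact_mod_cast hpu
    have hqv' : (v : ℝ) ≤ q.1 := by exact_mod_cast hqv
    have ep' : (σ : ℝ) * p.2 = m * p.1 + c := by exact_mod_cast ep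
    have eq' : (σ : ℝ) * q.2 = m * q.1 + c := by exact_mod_cast eq
    have hσ' : (σ : ℝ) * σ = 1 := by exact_mod_cast hσ
    have hmem := convex_hull S (ratPoint_mem_hull hp) (ratPoint_mem_hull hq)
      (a := (q.1 - x) / (q.1 - p.1)) (b := (x - p.1) / (q.1 - p.1))
      (div_nonneg (by linarith) hd'.le) (div_nonneg (by linarith) hd'.le)
      (by rw [← add_div, div_eq_one_iff_eq hd'.ne']; ring)
    convert hmem using 1
    have ep2 : (p.2 : ℝ) = σ * (m * p.1 + c) := by rw [← ep', ← mul_assoc, hσ', one_mul]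
    have eq2 : (q.2 : ℝ) = σ * (m * q.1 + c) := by rw [← eq', ← mul_assoc, hσ', one_mul]
    ext
    · simp only [ratPoint, Prod.fst_add, Prod.smul_fst, smul_eq_mul]
      field_simp
      ring
    · simp only [ratPoint, Prod.snd_add, Prod.smul_snd, smul_eq_mul]
      rw [ep2, eq2]
      field_simp
      ring
  · have := hull_subset_halfPlane (S := S) (α := -m) (β := σ) (γ := c) (fun r hr => by
      have h : (σ : ℝ) * r.2 ≤ m * r.1 + c := by exact_mod_cast hbelow r hr
      linarith) hy
    simp only at this
    linarith

theorem exists_columnSup_eq {S : Finset (ℚ × ℚ)} {σ u v : ℚ} (hσ : σ * σ = 1) (huv : u < v)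
    (hgap : ∀ p ∈ S, p.1 ≤ u ∨ v ≤ p.1) (hl : ∃ p ∈ S, p.1 ≤ u) (hr : ∃ p ∈ S, v ≤ p.1) :
    ∃ m c : ℚ, ∀ x : ℝ, u ≤ x → x ≤ v → columnSup (hull S) σ x = m * x + c := by
  obtain ⟨m, c, h⟩ := exists_line hσ huv hgap hl hr
  refine ⟨m, c, fun x hux hxv => IsGreatest.csSup_eq ⟨(h x hux hxv).1, fun y hy => ?_⟩⟩
  have := (h x hux hxv).2 _ hy
  rwa [← mul_assoc, show (σ : ℝ) * σ = 1 by exact_mod_cast hσ, one_mul] at this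

/-! ### Signed sums over columns. -/

/-- For `n > 0` the number of lattice points of `n P` with first coordinate `x`, for `n < 0` minus
the number of interior lattice points of `-n P` with first coordinate `-x`. -/
noncomputable def columnTerm (P : Set (ℝ × ℝ)) (n x : ℤ) : ℤ :=
  ⌊(n : ℝ) * columnSup P 1 (x / n)⌋ + ⌊(n : ℝ) * columnSup P (-1) (x / n)⌋ + 1

/-- The signed sum of the column terms over the interval `(n u, n v]` is quasi-quadratic. -/
def HasColumnSum (P : Set (ℝ × ℝ)) (u v : ℚ) : Prop :=
  ∃ T : ℤ → ℚ, IsQuasiQuadratic T ∧ T 0 = 0 ∧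
    (∀ n : ℤ, 0 < n → T n = ∑ x ∈ Finset.Ioc ⌊(n : ℚ) * u⌋ ⌊(n : ℚ) * v⌋, (columnTerm P n x : ℚ)) ∧
    (∀ n : ℤ, n < 0 → T n = - ∑ x ∈ Finset.Ioc ⌊(n : ℚ) * v⌋ ⌊(n : ℚ) * u⌋, (columnTerm P n x : ℚ))

theorem HasColumnSum.trans {P : Set (ℝ × ℝ)} {u v w : ℚ} (huv : u ≤ v) (hvw : v ≤ w)
    (h1 : HasColumnSum P u v) (h2 : HasColumnSum P v w) : HasColumnSum P u w := by
  obtain ⟨T, hT, hT0, hTp, hTn⟩ := h1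
  obtain ⟨T', hT', hT0', hTp', hTn'⟩ := h2
  refine ⟨fun n => T n + T' n, hT.add hT', by simp [hT0, hT0'], fun n hn => ?_, fun n hn => ?_⟩
  · have hn' : (0 : ℚ) < n := by exact_mod_cast hn
    dsimp only
    rw [hTp n hn, hTp' n hn, ← Finset.sum_union]
    · rw [Finset.Ioc_union_Ioc_eq_Ioc] <;> exact Int.floor_le_floor (by gcongr)
    · rw [Finset.disjoint_left]; intro x; simp; omega
  · have hn' : (n : ℚ) < 0 := by exact_mod_cast hn
    dsimp only
    rw [hTn n hn, hTn' n hn, ← neg_add, add_comm, ← Finset.sum_union]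
    · rw [Finset.Ioc_union_Ioc_eq_Ioc] <;>
        exact Int.floor_le_floor (mul_le_mul_of_nonpos_left (by assumption) hn'.le)
    · rw [Finset.disjoint_left]; intro x; simp; omega

theorem hasColumnSum_of_gap {S : Finset (ℚ × ℚ)} {u v : ℚ} (huv : u < v)
    (hgap : ∀ p ∈ S, p.1 ≤ u ∨ v ≤ p.1) (hl : ∃ p ∈ S, p.1 ≤ u) (hr : ∃ p ∈ S, v ≤ p.1) :
    HasColumnSum (hull S) u v := by
  obtain ⟨m, c, h⟩ := exists_columnSup_eq (σ := 1) (by norm_num) huv hgap hl hr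
  obtain ⟨m', c', h'⟩ := exists_columnSup_eq (σ := -1) (by norm_num) huv hgap hl hr
  have key : ∀ n x : ℤ, n ≠ 0 → (u : ℝ) ≤ x / n → (x / n : ℝ) ≤ v →
      columnTerm (hull S) n x = ⌊m * x + n * c⌋ + ⌊m' * x + n * c'⌋ + 1 := by
    intro n x hn h1 h2
    have hn' : (n : ℝ) ≠ 0 := by exact_mod_cast hn
    have e := h _ h1 h2
    have e' := h' _ h1 h2
    push_cast at e e'
    rw [columnTerm, e, e', ← Rat.floor_cast (α := ℝ), ← Rat.floor_cast (α := ℝ)]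
    congr 3
    · push_cast; field_simp
    · push_cast; field_simp
  obtain ⟨T, hT, hT0, hTp, hTn⟩ := exists_isQuasiQuadratic_sum m c m' c' huv.le
  refine ⟨T, hT, hT0, fun n hn => ?_, fun n hn => ?_⟩
  · rw [hTp n hn]
    refine Finset.sum_congr rfl fun x hx => ?_
    have hn' : (0 : ℝ) < n := by exact_mod_cast hn
    rw [Finset.mem_Ioc, Int.floor_lt, Int.le_floor] at hx
    have h1 : (n * u : ℝ) < x := by exact_mod_cast hx.1
    have h2 : (x : ℝ) ≤ n * v := by exact_mod_cast hx.2
    rw [key n x hn.ne' (by rw [le_div_iff₀ hn']; linarith) (by rw [div_le_iff₀ hn']; linarith)]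
  · rw [hTn n hn]
    congr 1
    refine Finset.sum_congr rfl fun x hx => ?_
    have hn' : (n : ℝ) < 0 := by exact_mod_cast hn
    rw [Finset.mem_Ioc, Int.floor_lt, Int.le_floor] at hx
    have h1 : (n * v : ℝ) < x := by exact_mod_cast hx.1
    have h2 : (x : ℝ) ≤ n * u := by exact_mod_cast hx.2
    rw [key n x hn.ne (by rw [le_div_iff_of_neg hn']; linarith)
      (by rw [div_le_iff_of_neg hn']; linarith)]

/-- Cutting at the first coordinate of a generator strictly between `u` and `v` leaves fewer such
generators on both sides. When none is left, the boundary is linear over the interval. -/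
theorem hasColumnSum_hull {S : Finset (ℚ × ℚ)} {u v : ℚ} (huv : u < v)
    (hl : ∃ p ∈ S, p.1 ≤ u) (hr : ∃ p ∈ S, v ≤ p.1) : HasColumnSum (hull S) u v := by
  induction hk : (S.filter fun p => u < p.1 ∧ p.1 < v).card using Nat.strong_induction_on
    generalizing u v with
  | _ k ih =>
    by_cases hgap : ∀ p ∈ S, p.1 ≤ u ∨ v ≤ p.1
    · exact hasColumnSum_of_gap huv hgap hl hr
    push Not at hgap
    obtain ⟨p, hp, hup, hpv⟩ := hgap
    refine HasColumnSum.trans hup.le hpv.le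
      (ih _ ?_ hup hl ⟨p, hp, le_rfl⟩ rfl) (ih _ ?_ hpv ⟨p, hp, le_rfl⟩ hr rfl)
    all_goals
      rw [← hk]
      refine Finset.card_lt_card ((Finset.ssubset_iff_of_subset fun q => ?_).2 ⟨p, ?_, ?_⟩)
      · simp only [Finset.mem_filter]
        rintro ⟨h1, h2, h3⟩
        exact ⟨h1, by linarith, by linarith⟩
      · simp [hp, hup, hpv]
      · simp

/-! ### Membership and interior in terms of columns. -/

theorem columnSup_mem {P : Set (ℝ × ℝ)} (hP : IsCompact P) {σ x y : ℝ} (hσ : σ * σ = 1)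
    (hy : (x, y) ∈ P) : (x, σ * columnSup P σ x) ∈ P ∧ σ * y ≤ columnSup P σ x := by
  have hmem : σ * y ∈ {y | (x, σ * y) ∈ P} := by
    show (x, σ * (σ * y)) ∈ P
    rwa [← mul_assoc, hσ, one_mul]
  have hclosed : IsClosed {y | (x, σ * y) ∈ P} :=
    hP.isClosed.preimage (by fun_prop : Continuous fun y : ℝ => (x, σ * y))
  have hbdd : BddAbove {y | (x, σ * y) ∈ P} := by
    obtain ⟨M, hM⟩ := (hP.image (f := fun z : ℝ × ℝ => σ * z.2) (by fun_prop)).bddAbove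
    refine ⟨M, fun y hy => hM ⟨_, hy, ?_⟩⟩
    simp only
    rw [← mul_assoc, hσ, one_mul]
  exact ⟨hclosed.csSup_mem ⟨_, hmem⟩ hbdd, le_csSup hbdd hmem⟩

theorem mem_iff_le_columnSup {P : Set (ℝ × ℝ)} (hP : IsCompact P) (hconv : Convex ℝ P) {x : ℝ}
    (hx : ∃ y, (x, y) ∈ P) (y : ℝ) :
    (x, y) ∈ P ↔ y ≤ columnSup P 1 x ∧ -y ≤ columnSup P (-1) x := by
  constructor
  · intro hy
    have h1 := (columnSup_mem hP (σ := 1) (by norm_num) hy).2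
    have h2 := (columnSup_mem hP (σ := -1) (by norm_num) hy).2
    exact ⟨by linarith, by linarith⟩
  · rintro ⟨h1, h2⟩
    obtain ⟨y₀, hy₀⟩ := hx
    have m1 := (columnSup_mem hP (σ := 1) (by norm_num) hy₀).1
    have m2 := (columnSup_mem hP (σ := -1) (by norm_num) hy₀).1
    set g := columnSup P 1 x
    set f := columnSup P (-1) x
    have hc : Convex ℝ {t : ℝ | (x, t) ∈ P} := by
      intro s hs t ht a b ha hb hab
      have := hconv hs ht ha hb hab
      simpa [← add_mul, hab] using this
    refine hc.ordConnected.out (x := -1 * f) (y := 1 * g) m2 m1 ⟨by linarith, by linarith⟩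

/-- The interior of a compact convex set with nonempty interior, in terms of its columns. -/
theorem mem_interior_iff_lt_columnSup {P : Set (ℝ × ℝ)} (hP : IsCompact P) (hconv : Convex ℝ P)
    (hne : (interior P).Nonempty) {A B : ℝ × ℝ} (hA : A ∈ P) (hB : B ∈ P)
    (hAB : ∀ z ∈ P, A.1 ≤ z.1 ∧ z.1 ≤ B.1) (hcol : ∀ x, A.1 ≤ x → x ≤ B.1 → ∃ y, (x, y) ∈ P)
    (x y : ℝ) : (x, y) ∈ interior P ↔
      (A.1 < x ∧ x < B.1) ∧ y < columnSup P 1 x ∧ -y < columnSup P (-1) x := by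
  constructor
  · intro hz
    obtain ⟨δ, hδ, hball⟩ := Metric.mem_nhds_iff.1 (mem_interior_iff_mem_nhds.1 hz)
    have near : ∀ s t : ℝ, |s| < δ → |t| < δ → (x + s, y + t) ∈ P := by
      intro s t hs ht
      refine hball ?_
      rw [Metric.mem_ball, Prod.dist_eq]
      simpa [Real.dist_eq] using ⟨hs, ht⟩
    have hd : |δ / 2| < δ := by rw [abs_of_pos (by linarith)]; linarith
    have hd' : |-(δ / 2)| < δ := by rwa [abs_neg]
    have h0 : |(0 : ℝ)| < δ := by simpa using hδ
    have e1 := (hAB _ (near _ _ hd h0)).2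
    have e2 := (hAB _ (near _ _ hd' h0)).1
    have e3 := (columnSup_mem hP (σ := 1) (by norm_num) (near _ _ h0 hd)).2
    have e4 := (columnSup_mem hP (σ := -1) (by norm_num) (near _ _ h0 hd')).2
    simp only [add_zero] at e1 e2 e3 e4
    exact ⟨⟨by linarith, by linarith⟩, by linarith, by linarith⟩
  · rintro ⟨⟨hax, hxb⟩, hg, hf⟩
    by_contra hz
    -- The functional `φ` attains its maximum over `P` and `(x, y)` at `(x, y)`. The top and bottom
    -- of the column lie strictly above and below, which kills its vertical coefficient. Then `A`
    -- and `B`, strictly on either side, kill the horizontal one, contradicting strictness at the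
    -- interior point `w`.
    obtain ⟨φ, hφ⟩ := geometric_hahn_banach_open_point hconv.interior isOpen_interior hz
    have hle : ∀ a ∈ P, φ a ≤ φ (x, y) := by
      have hcl : IsClosed {a | φ a ≤ φ (x, y)} := isClosed_le φ.continuous continuous_const
      have hsub : closure (interior P) ⊆ {a | φ a ≤ φ (x, y)} :=
        closure_minimal (fun a ha => (hφ a ha).le) hcl
      rw [hconv.closure_interior_eq_closure_of_nonempty_interior hne] at hsub
      exact fun a ha => hsub (subset_closure ha)
    have hlin : ∀ s t : ℝ, φ (s, t) = φ (1, 0) * s + φ (0, 1) * t := by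
      intro s t
      have : ((s, t) : ℝ × ℝ) = s • (1, 0) + t • (0, 1) := by simp
      rw [this, map_add, map_smul, map_smul, smul_eq_mul, smul_eq_mul]
      ring
    obtain ⟨y₀, hy₀⟩ := hcol x hax.le hxb.le
    have h1 := hle _ (columnSup_mem hP (σ := 1) (by norm_num) hy₀).1
    have h2 := hle _ (columnSup_mem hP (σ := -1) (by norm_num) hy₀).1
    have h3 := hle _ hA
    have h4 := hle _ hB
    obtain ⟨w, hw⟩ := hne
    have h5 := hφ w hw
    rw [hlin, hlin x y] at h1 h2 h3 h4 h5
    have hb : φ (0, 1) = 0 := by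
      apply le_antisymm <;> by_contra! h <;> nlinarith
    rw [hb] at h3 h4 h5
    have ha : φ (1, 0) = 0 := by
      apply le_antisymm <;> by_contra! h <;> nlinarith
    rw [ha] at h5
    linarith

theorem interior_convexHull_nonempty_of_not_collinear {s : Set (ℝ × ℝ)}
    (hs : ¬ Collinear ℝ s) : (interior (convexHull ℝ s)).Nonempty := by
  rw [interior_convexHull_nonempty_iff_affineSpan_eq_top]
  have hne : s.Nonempty := by
    rw [Set.nonempty_iff_ne_empty]
    rintro rfl
    exact hs (collinear_empty ℝ _)
  rw [AffineSubspace.affineSpan_eq_top_iff_vectorSpan_eq_top_of_nonempty ℝ _ _ hne]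
  rw [collinear_iff_finrank_le_one] at hs
  apply Submodule.eq_top_of_finrank_eq
  have := Submodule.finrank_le (vectorSpan ℝ s)
  simp only [Module.finrank_prod, Module.finrank_self] at *
  omega

/-! ### Ehrhart's theorem and reciprocity. -/

/-- Counting lattice points column by column. -/
theorem latticeCount_eq_sum {Q : Set (ℝ × ℝ)} (s : Finset ℤ) (t : ℤ → Finset ℤ)
    (h : ∀ x y : ℤ, ((x : ℝ), (y : ℝ)) ∈ Q ↔ x ∈ s ∧ y ∈ t x) :
    latticeCount Q = ∑ x ∈ s, (t x).card := by
  have hinj : Function.Injective fun z : (_ : ℤ) × ℤ => ((z.1 : ℝ), (z.2 : ℝ)) := by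
    rintro ⟨x, y⟩ ⟨x', y'⟩ h
    simpa using h
  have : Q ∩ lattice = (fun z : (_ : ℤ) × ℤ => ((z.1 : ℝ), (z.2 : ℝ))) '' (s.sigma t : Set _) := by
    ext z
    constructor
    · rintro ⟨hz, ⟨x, y⟩, rfl⟩
      exact ⟨⟨x, y⟩, by simpa using (h x y).1 hz, rfl⟩
    · rintro ⟨⟨x, y⟩, hxy, rfl⟩
      exact ⟨(h x y).2 (by simpa using hxy), ⟨(x, y), rfl⟩⟩
  rw [latticeCount, this, Set.ncard_image_of_injective _ hinj, Set.ncard_coe_finset,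
    Finset.card_sigma]

theorem mem_dilate_iff {n : ℕ} (hn : 0 < n) {P : Set (ℝ × ℝ)} {x y : ℝ} :
    (x, y) ∈ dilate n P ↔ (x / n, y / n) ∈ P := by
  have hn' : (n : ℝ) ≠ 0 := by exact_mod_cast hn.ne'
  constructor
  · rintro ⟨⟨a, b⟩, h, e⟩
    simp only [Prod.smul_mk, smul_eq_mul, Prod.mk.injEq] at e
    rw [← e.1, ← e.2]
    field_simp
    exact h
  · intro h
    refine ⟨_, h, ?_⟩
    ext <;> simp <;> field_simp

theorem interior_dilate {n : ℕ} (hn : 0 < n) (P : Set (ℝ × ℝ)) :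
    interior (dilate n P) = dilate n (interior P) := by
  have hn' : (n : ℝ) ≠ 0 := by exact_mod_cast hn.ne'
  exact interior_smul₀ hn' P

/-- Together with `sum_Icc_ceil` this isolates the end column: the closed polygon needs it added to
the half-open sum, the interior needs it removed. It exists only when `w` is an integer. -/
theorem sum_Ioc_floor {p : ℤ} {w : ℚ} (hp : (p : ℚ) < w) (F : ℤ → ℚ) :
    ∑ x ∈ Finset.Ioc p ⌊w⌋, F x
      = ∑ x ∈ Finset.Ioc p (⌈w⌉ - 1), F x + if (⌊w⌋ : ℚ) = w then F ⌊w⌋ else 0 := by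
  split_ifs with h
  · have hc : ⌈w⌉ = ⌊w⌋ := by rw [← h]; simp
    have hp' : p < ⌊w⌋ := by rw [← h] at hp; exact_mod_cast hp
    have : Finset.Ioc p ⌊w⌋ = insert ⌊w⌋ (Finset.Ioc p (⌈w⌉ - 1)) := by ext; simp; omega
    rw [this, Finset.sum_insert (by simp; omega), add_comm]
  · have hc : ⌈w⌉ = ⌊w⌋ + 1 := by
      rw [Int.ceil_eq_iff]
      have := (Int.floor_le w).lt_of_ne h
      push_cast
      exact ⟨by linarith, (Int.lt_floor_add_one w).le⟩
    rw [hc, add_sub_cancel_right, add_zero]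

theorem sum_Icc_ceil {q : ℤ} {w : ℚ} (hq : ⌊w⌋ ≤ q) (F : ℤ → ℚ) :
    ∑ x ∈ Finset.Icc ⌈w⌉ q, F x
      = ∑ x ∈ Finset.Ioc ⌊w⌋ q, F x + if (⌊w⌋ : ℚ) = w then F ⌊w⌋ else 0 := by
  split_ifs with h
  · have hc : ⌈w⌉ = ⌊w⌋ := by rw [← h]; simp
    have : Finset.Icc ⌈w⌉ q = insert ⌊w⌋ (Finset.Ioc ⌊w⌋ q) := by ext; simp; omega
    rw [this, Finset.sum_insert (by simp), add_comm]
  · have hc : ⌈w⌉ = ⌊w⌋ + 1 := by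
      rw [Int.ceil_eq_iff]
      have := (Int.floor_le w).lt_of_ne h
      push_cast
      exact ⟨by linarith, (Int.lt_floor_add_one w).le⟩
    have : Finset.Icc ⌈w⌉ q = Finset.Ioc ⌊w⌋ q := by ext; simp; omega
    rw [this, add_zero]

/-- The width of a rational polygon is realized by two of its generators, and the column
description of membership and interior holds over that range. -/
theorem exists_columns {S : Finset (ℚ × ℚ)}
    (hS : ¬ Collinear ℝ (ratPoint '' (S : Set (ℚ × ℚ)))) :
    ∃ A ∈ S, ∃ B ∈ S, A.1 < B.1 ∧
      (∀ x y : ℝ, (x, y) ∈ hull S ↔ (A.1 ≤ x ∧ x ≤ B.1) ∧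
        y ≤ columnSup (hull S) 1 x ∧ -y ≤ columnSup (hull S) (-1) x) ∧
      (∀ x y : ℝ, (x, y) ∈ interior (hull S) ↔ (A.1 < x ∧ x < B.1) ∧
        y < columnSup (hull S) 1 x ∧ -y < columnSup (hull S) (-1) x) ∧
      (∀ x : ℝ, A.1 ≤ x → x ≤ B.1 →
        0 ≤ columnSup (hull S) 1 x + columnSup (hull S) (-1) x) ∧
      (∀ x : ℝ, A.1 < x → x < B.1 →
        0 < columnSup (hull S) 1 x + columnSup (hull S) (-1) x) := by
  have hint : (interior (hull S)).Nonempty := interior_convexHull_nonempty_of_not_collinear hS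
  have hne : S.Nonempty := by
    rw [Finset.nonempty_iff_ne_empty]
    rintro rfl
    simp [collinear_empty] at hS
  obtain ⟨A, hA, hmin⟩ := Finset.exists_min_image S Prod.fst hne
  obtain ⟨B, hB, hmax⟩ := Finset.exists_max_image S Prod.fst hne
  have hcomp := isCompact_hull S
  have hconv := convex_hull S
  have hAB : ∀ z ∈ hull S, (A.1 : ℝ) ≤ z.1 ∧ z.1 ≤ (B.1 : ℝ) := by
    intro z hz
    constructor
    · have := hull_subset_halfPlane (α := -1) (β := 0) (γ := -A.1) (fun p hp => by
        have : (A.1 : ℝ) ≤ p.1 := by exact_mod_cast hmin p hp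
        linarith) hz
      linarith
    · have := hull_subset_halfPlane (α := 1) (β := 0) (γ := B.1) (fun p hp => by
        have : (p.1 : ℝ) ≤ B.1 := by exact_mod_cast hmax p hp
        linarith) hz
      linarith
  have hcol : ∀ x : ℝ, A.1 ≤ x → x ≤ B.1 → ∃ y, (x, y) ∈ hull S := by
    intro x hax hxb
    have hI := (hconv.linear_image (LinearMap.fst ℝ ℝ ℝ)).ordConnected.out
      ⟨_, ratPoint_mem_hull hA, rfl⟩ ⟨_, ratPoint_mem_hull hB, rfl⟩ (a := x) ⟨hax, hxb⟩
    obtain ⟨⟨x', y⟩, h, rfl⟩ := hI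
    exact ⟨y, h⟩
  have hintiff := mem_interior_iff_lt_columnSup hcomp hconv hint (ratPoint_mem_hull hA)
    (ratPoint_mem_hull hB) hAB hcol
  simp only [ratPoint] at hintiff
  obtain ⟨⟨x₀, y₀⟩, h₀⟩ := hint
  have h₀' := (hintiff x₀ y₀).1 h₀
  refine ⟨A, hA, B, hB, ?_, ?_, hintiff, ?_, ?_⟩
  · exact_mod_cast h₀'.1.1.trans h₀'.1.2
  · intro x y
    constructor
    · intro h
      exact ⟨hAB _ h, (mem_iff_le_columnSup hcomp hconv ⟨y, h⟩ y).1 h⟩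
    · rintro ⟨hx, h⟩
      exact (mem_iff_le_columnSup hcomp hconv (hcol x hx.1 hx.2) y).2 h
  · intro x h1 h2
    obtain ⟨y, hy⟩ := hcol x h1 h2
    have := (mem_iff_le_columnSup hcomp hconv ⟨y, hy⟩ y).1 hy
    linarith
  · intro x h1 h2
    have hI : ∃ y, (x, y) ∈ interior (hull S) := by
      have key : ∀ p ∈ S, x ∈ openSegment ℝ x₀ (p.1 : ℝ) → ∃ y, (x, y) ∈ interior (hull S) := by
        rintro p hp ⟨a, b, ha, hb, hab, rfl⟩
        refine ⟨_, hconv.openSegment_interior_self_subset_interior h₀ (ratPoint_mem_hull hp)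
          ⟨a, b, ha, hb, hab, rfl⟩⟩
      rcases lt_trichotomy x x₀ with h | h | h
      · refine key A hA ?_
        rw [openSegment_symm, openSegment_eq_Ioo (h1.trans h)]
        exact ⟨h1, h⟩
      · exact ⟨y₀, h ▸ h₀⟩
      · refine key B hB ?_
        rw [openSegment_eq_Ioo (h.trans h2)]
        exact ⟨h, h2⟩
    obtain ⟨y, hy⟩ := hI
    have := ((hintiff x y).1 hy).2
    linarith

/-- Rationality of the ends of the leftmost column is what `isQuasiQuadratic_column` needs. It
follows from linearity of the boundary up to the next first coordinate of a generator. -/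
theorem exists_columnSup_left {S : Finset (ℚ × ℚ)} {σ : ℚ} (hσ : σ * σ = 1) {A B : ℚ × ℚ}
    (hA : A ∈ S) (hB : B ∈ S) (hAB : A.1 < B.1) : ∃ s : ℚ, columnSup (hull S) σ A.1 = s := by
  obtain ⟨q, hq, hmin⟩ := Finset.exists_min_image (S.filter fun p => A.1 < p.1) Prod.fst
    ⟨B, by simp [hB, hAB]⟩
  simp only [Finset.mem_filter] at hq hmin
  obtain ⟨m, c, h⟩ := exists_columnSup_eq hσ hq.2 (fun p hp => by
    rcases le_or_gt p.1 A.1 with h | h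
    · exact Or.inl h
    · exact Or.inr (hmin p ⟨hp, h⟩)) ⟨A, hA, le_rfl⟩ ⟨q, hq.1, le_rfl⟩
  exact ⟨m * A.1 + c, by rw [h _ le_rfl (by exact_mod_cast hq.2.le)]; push_cast; rfl⟩

/-- Ehrhart's theorem and Ehrhart–Macdonald reciprocity for rational polygons. -/
theorem exists_ehrhart_reciprocity {S : Finset (ℚ × ℚ)}
    (hS : ¬ Collinear ℝ (ratPoint '' (S : Set (ℚ × ℚ)))) :
    ∃ E : ℤ → ℚ, IsQuasiQuadratic E ∧ E 0 = 1 ∧ ∀ n : ℕ, 0 < n →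
      E n = latticeCount (dilate n (hull S)) ∧
      E (-n) = latticeCount (interior (dilate n (hull S))) := by
  obtain ⟨A, hA, B, hB, hAB, hmem, hint, hnonneg, hpos⟩ := exists_columns hS
  obtain ⟨s, hs⟩ := exists_columnSup_left (σ := 1) (by norm_num) hA hB hAB
  obtain ⟨t, ht⟩ := exists_columnSup_left (σ := -1) (by norm_num) hA hB hAB
  push_cast at hs ht
  obtain ⟨T, hT, hT0, hTp, hTn⟩ := hasColumnSum_hull hAB ⟨A, hA, le_rfl⟩ ⟨B, hB, le_rfl⟩
  have hleft : ∀ n : ℤ, n ≠ 0 → (⌊(n : ℚ) * A.1⌋ : ℚ) = n * A.1 →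
      ⌊(n : ℚ) * s⌋ + ⌊(n : ℚ) * t⌋ + 1 = columnTerm (hull S) n ⌊(n : ℚ) * A.1⌋ := by
    intro n hn h
    have hn' : (n : ℝ) ≠ 0 := by exact_mod_cast hn
    have h' : (⌊(n : ℚ) * A.1⌋ : ℝ) = n * A.1 := by exact_mod_cast h
    rw [columnTerm, h', mul_div_cancel_left₀ _ hn', hs, ht, ← Rat.floor_cast (α := ℝ),
      ← Rat.floor_cast (α := ℝ)]
    push_cast
    rfl
  refine ⟨fun n => T n + if (⌊(n : ℚ) * A.1⌋ : ℚ) = n * A.1 then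
    ((⌊(n : ℚ) * s⌋ + ⌊(n : ℚ) * t⌋ + 1 : ℤ) : ℚ) else 0,
    hT.add (isQuasiQuadratic_column A.1 s t), by simp [hT0], fun n hn => ?_⟩
  have hn' : (0 : ℝ) < n := by exact_mod_cast hn
  have hnq : (0 : ℚ) < n := by exact_mod_cast hn
  have hlt : (n : ℚ) * A.1 < n * B.1 := by gcongr
  constructor
  · rw [latticeCount_eq_sum (Finset.Icc ⌈(n : ℚ) * A.1⌉ ⌊(n : ℚ) * B.1⌋)
      (fun x => Finset.Icc (-⌊(n : ℝ) * columnSup (hull S) (-1) (x / n)⌋)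
        ⌊(n : ℝ) * columnSup (hull S) 1 (x / n)⌋)]
    · push_cast
      rw [Finset.sum_congr rfl (g := fun x => (columnTerm (hull S) n x : ℚ)),
        sum_Icc_ceil (Int.floor_le_floor hlt.le), hTp n (by exact_mod_cast hn)]
      · push_cast
        congr 1
        split_ifs with h
        · have := hleft n (by exact_mod_cast hn.ne') (by exact_mod_cast h)
          exact_mod_cast this
        · rfl
      · intro x hx
        rw [Finset.mem_Icc, Int.ceil_le, Int.le_floor] at hx
        have h1 : (n * A.1 : ℝ) ≤ x := by exact_mod_cast hx.1
        have h2 : (x : ℝ) ≤ n * B.1 := by exact_mod_cast hx.2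
        have h3 := hnonneg (x / n) (by rw [le_div_iff₀ hn']; linarith)
          (by rw [div_le_iff₀ hn']; linarith)
        have h4 := Int.lt_floor_add_one ((n : ℝ) * columnSup (hull S) (-1) (x / n))
        have h5 := Int.lt_floor_add_one ((n : ℝ) * columnSup (hull S) 1 (x / n))
        -- The two floors add up to at least `-1`, so the column term is never negative and is the
        -- exact count even for a column without lattice points.
        have h6 : (-2 : ℝ) < (⌊(n : ℝ) * columnSup (hull S) (-1) (x / n)⌋
          + ⌊(n : ℝ) * columnSup (hull S) 1 (x / n)⌋ : ℤ) := by
          push_cast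
          nlinarith [mul_nonneg hn'.le h3]
        have h7 : (-2 : ℤ) < ⌊(n : ℝ) * columnSup (hull S) (-1) (x / n)⌋
          + ⌊(n : ℝ) * columnSup (hull S) 1 (x / n)⌋ := by exact_mod_cast h6
        have h8 : ((Finset.Icc (-⌊(n : ℝ) * columnSup (hull S) (-1) (x / n)⌋)
          ⌊(n : ℝ) * columnSup (hull S) 1 (x / n)⌋).card : ℤ) = columnTerm (hull S) n x := by
          rw [Int.card_Icc, columnTerm, Int.toNat_of_nonneg (by omega)]
          push_cast
          ring
        exact_mod_cast h8
    · intro x y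
      rw [mem_dilate_iff hn, hmem, Finset.mem_Icc, Finset.mem_Icc, Int.ceil_le, Int.le_floor,
        Int.le_floor, neg_le (a := ⌊(n : ℝ) * columnSup (hull S) (-1) (x / n)⌋), Int.le_floor, le_div_iff₀ hn', div_le_iff₀ hn', div_le_iff₀ hn',
        ← neg_div, div_le_iff₀ hn', mul_comm _ (n : ℝ), mul_comm _ (n : ℝ), mul_comm _ (n : ℝ),
        mul_comm _ (n : ℝ), and_comm (a := (y : ℝ) ≤ _)]
      push_cast
      norm_cast
  · rw [interior_dilate hn, latticeCount_eq_sum (Finset.Ioo ⌊(n : ℚ) * A.1⌋ ⌈(n : ℚ) * B.1⌉)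
      (fun x => Finset.Ioo (-⌈(n : ℝ) * columnSup (hull S) (-1) (x / n)⌉)
        ⌈(n : ℝ) * columnSup (hull S) 1 (x / n)⌉)]
    · have hf : ⌊((-n : ℤ) : ℚ) * B.1⌋ = -⌈(n : ℚ) * B.1⌉ := by
        rw [← Int.floor_neg]; push_cast; rw [neg_mul]
      have hc : ⌈((-n : ℤ) : ℚ) * A.1⌉ = -⌊(n : ℚ) * A.1⌋ := by
        rw [← Int.ceil_neg]; push_cast; rw [neg_mul]
      dsimp only
      rw [hTn (-n) (by omega), sum_Ioc_floor, hf, hc]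
      -- Reciprocity in one column, from `⌊-t⌋ = -⌈t⌉`. Positive height over the open range makes
      -- the two ceilings add up to at least `1`, so the cardinality is not truncated.
      · have hterm : ∀ x ∈ Finset.Ioo ⌊(n : ℚ) * A.1⌋ ⌈(n : ℚ) * B.1⌉,
            ((Finset.Ioo (-⌈(n : ℝ) * columnSup (hull S) (-1) (x / n)⌉)
              ⌈(n : ℝ) * columnSup (hull S) 1 (x / n)⌉).card : ℚ)
              = -(columnTerm (hull S) (-n) (-x) : ℚ) := by
          intro x hx
          rw [Finset.mem_Ioo, Int.lt_ceil, Int.floor_lt] at hx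
          have h1 : (n * A.1 : ℝ) < x := by exact_mod_cast hx.1
          have h2 : (x : ℝ) < n * B.1 := by exact_mod_cast hx.2
          have h3 := hpos (x / n) (by rw [lt_div_iff₀ hn']; linarith)
            (by rw [div_lt_iff₀ hn']; linarith)
          have h4 := Int.le_ceil ((n : ℝ) * columnSup (hull S) (-1) (x / n))
          have h5 := Int.le_ceil ((n : ℝ) * columnSup (hull S) 1 (x / n))
          have h6 : (0 : ℝ) < (⌈(n : ℝ) * columnSup (hull S) (-1) (x / n)⌉
            + ⌈(n : ℝ) * columnSup (hull S) 1 (x / n)⌉ : ℤ) := by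
            push_cast
            nlinarith [mul_pos hn' h3]
          have h7 : (0 : ℤ) < ⌈(n : ℝ) * columnSup (hull S) (-1) (x / n)⌉
            + ⌈(n : ℝ) * columnSup (hull S) 1 (x / n)⌉ := by exact_mod_cast h6
          have h8 : ((Finset.Ioo (-⌈(n : ℝ) * columnSup (hull S) (-1) (x / n)⌉)
            ⌈(n : ℝ) * columnSup (hull S) 1 (x / n)⌉).card : ℤ)
              = -columnTerm (hull S) (-n) (-x) := by
            rw [Int.card_Ioo, columnTerm, Int.toNat_of_nonneg (by omega)]
            push_cast
            rw [neg_div_neg_eq, neg_mul, neg_mul, Int.floor_neg, Int.floor_neg]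
            ring
          exact_mod_cast h8
        push_cast
        rw [Finset.sum_congr rfl hterm, Finset.sum_neg_distrib, neg_add, add_assoc]
        -- At `-n` the half-open sum contains the leftmost column, and the extra term of `E` cancels
        -- it. The remaining sums correspond under `x ↦ -x`.
        convert add_zero _ using 2
        · split_ifs with h
          · have := hleft (-n) (by omega) (by exact_mod_cast h)
            push_cast at this
            have h9 : ((⌊-(n : ℚ) * s⌋ + ⌊-(n : ℚ) * t⌋ + 1 : ℤ) : ℚ)
              = (columnTerm (hull S) (-n) ⌊-(n : ℚ) * A.1⌋ : ℤ) := by exact_mod_cast this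
            push_cast at h9
            rw [h9]
            ring
          · simp
        · refine Finset.sum_nbij' (fun x => -x) (fun x => -x) ?_ ?_ ?_ ?_ ?_
          · intro x; simp only [Finset.mem_Ioo, Finset.mem_Ioc]; omega
          · intro x; simp only [Finset.mem_Ioo, Finset.mem_Ioc]; omega
          · intro x _; simp
          · intro x _; simp
          · intro x _; simp
      · refine (Int.floor_le _).trans_lt ?_
        push_cast
        linarith
    · intro x y
      rw [mem_dilate_iff hn, hint, Finset.mem_Ioo, Finset.mem_Ioo, Int.floor_lt, Int.lt_ceil,
        Int.lt_ceil, neg_lt (a := ⌈(n : ℝ) * columnSup (hull S) (-1) (x / n)⌉), Int.lt_ceil, lt_div_iff₀ hn', div_lt_iff₀ hn', div_lt_iff₀ hn',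
        ← neg_div, div_lt_iff₀ hn', mul_comm _ (n : ℝ), mul_comm _ (n : ℝ), mul_comm _ (n : ℝ),
        mul_comm _ (n : ℝ), and_comm (a := (y : ℝ) < _)]
      push_cast
      norm_cast

/-! ### Consequences for pseudo-integral polygons. -/

theorem finite_inter_lattice {P : Set (ℝ × ℝ)} (hP : IsCompact P) : (P ∩ lattice).Finite := by
  obtain ⟨M, hM⟩ := hP.isBounded.exists_norm_le
  refine (((Finset.Icc (-⌈M⌉) ⌈M⌉ ×ˢ Finset.Icc (-⌈M⌉) ⌈M⌉).finite_toSet).image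
    fun z : ℤ × ℤ => ((z.1 : ℝ), (z.2 : ℝ))).subset ?_
  rintro _ ⟨hz, ⟨x, y⟩, rfl⟩
  refine ⟨(x, y), ?_, rfl⟩
  have h := (hM _ hz).trans (Int.le_ceil M)
  rw [Prod.norm_def, max_le_iff, Real.norm_eq_abs, Real.norm_eq_abs, abs_le, abs_le] at h
  dsimp only at h
  have h' : ((-⌈M⌉ ≤ x ∧ x ≤ ⌈M⌉) ∧ -⌈M⌉ ≤ y ∧ y ≤ ⌈M⌉) := by exact_mod_cast h
  simpa using ⟨⟨h'.1.1, h'.2.1⟩, h'.1.2, h'.2.2⟩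

theorem interiorCount_add_boundaryCount {P : Set (ℝ × ℝ)} (hP : IsCompact P) :
    interiorCount P + boundaryCount P = latticeCount P := by
  have hfin := finite_inter_lattice hP
  rw [interiorCount, boundaryCount, latticeCount, latticeCount, latticeCount,
    hP.isClosed.frontier_eq, ← Set.ncard_union_eq ?_
      (hfin.subset (Set.inter_subset_inter_left _ interior_subset))
      (hfin.subset (Set.inter_subset_inter_left _ Set.sdiff_subset))]
  · congr 1
    ext z
    have : z ∈ interior P → z ∈ P := fun h => interior_subset h
    simp only [Set.mem_union, Set.mem_inter_iff, Set.mem_sdiff]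
    tauto
  · rw [Set.disjoint_left]
    rintro z ⟨h, -⟩ ⟨h', -⟩
    exact h'.2 h

theorem dilate_one (P : Set (ℝ × ℝ)) : dilate 1 P = P := by simp [dilate]

/-- A generator with minimal first coordinate lies on the boundary, and multiplying by its
denominators makes it a lattice point. This is what rules out a vanishing linear coefficient. -/
theorem exists_latticeCount_interior_lt {S : Finset (ℚ × ℚ)}
    (hS : ¬ Collinear ℝ (ratPoint '' (S : Set (ℚ × ℚ)))) : ∃ n : ℕ, 0 < n ∧
      latticeCount (interior (dilate n (hull S))) < latticeCount (dilate n (hull S)) := by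
  obtain ⟨A, hA, B, -, -, -, hint, -⟩ := exists_columns hS
  have hn : 0 < A.1.den * A.2.den := Nat.mul_pos A.1.den_pos A.2.den_pos
  have hn' : ((A.1.den * A.2.den : ℕ) : ℝ) ≠ 0 := by exact_mod_cast hn.ne'
  refine ⟨_, hn, ?_⟩
  have h1 : (A.1 : ℝ) * A.1.den = A.1.num := by exact_mod_cast Rat.mul_den_eq_num A.1
  have h2 : (A.2 : ℝ) * A.2.den = A.2.num := by exact_mod_cast Rat.mul_den_eq_num A.2
  have e1 : ((A.1.num * A.2.den : ℤ) : ℝ) / (A.1.den * A.2.den : ℕ) = A.1 := by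
    rw [div_eq_iff hn']; push_cast; rw [← h1]; ring
  have e2 : ((A.2.num * A.1.den : ℤ) : ℝ) / (A.1.den * A.2.den : ℕ) = A.2 := by
    rw [div_eq_iff hn']; push_cast; rw [← h2]; ring
  have hcomp : IsCompact (dilate (A.1.den * A.2.den) (hull S)) :=
    (isCompact_hull S).image (by fun_prop)
  refine Set.ncard_lt_ncard ((Set.ssubset_iff_of_subset
    (Set.inter_subset_inter_left _ interior_subset)).2
    ⟨(((A.1.num * A.2.den : ℤ) : ℝ), ((A.2.num * A.1.den : ℤ) : ℝ)), ⟨?_, ⟨(_, _), rfl⟩⟩, ?_⟩)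
    (finite_inter_lattice hcomp)
  · rw [mem_dilate_iff hn, e1, e2]
    exact ratPoint_mem_hull hA
  · rintro ⟨h, -⟩
    rw [interior_dilate hn, mem_dilate_iff hn, e1, e2, hint] at h
    exact lt_irrefl _ h.1.1

theorem eq_of_minPeriod_eq_one {f : ℤ → ℚ}
    (hf : ∃ s : ℕ, 0 < s ∧ Function.Periodic f (s : ℤ)) (h : minPeriod f = 1) (n : ℤ) :
    f n = f 0 := by
  have hmem : minPeriod f ∈ {s : ℕ | 0 < s ∧ Function.Periodic f (s : ℤ)} := Nat.sInf_mem hf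
  rw [h] at hmem
  simpa using hmem.2.int_mul n 0

theorem minPeriod_const (a : ℚ) : minPeriod (fun _ => a) = 1 := by
  have h : (1 : ℕ) ∈ {s : ℕ | 0 < s ∧ Function.Periodic (fun _ : ℤ => a) (s : ℤ)} :=
    ⟨one_pos, fun _ => rfl⟩
  exact le_antisymm (Nat.sInf_le h) (Nat.sInf_mem ⟨1, h⟩).1

/-- A rational polygon is pseudo-integral exactly if its lattice point enumerator is a polynomial. -/
theorem isPIP_iff {P : Set (ℝ × ℝ)} : IsPIP P ↔ IsRationalPolygon P ∧
    ∃ a b c : ℚ, ∀ n : ℕ, 0 < n → (latticeCount (dilate n P) : ℚ) = a * n ^ 2 + b * n + c := by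
  refine and_congr_right fun _ => ⟨?_, ?_⟩
  · rintro ⟨c, hc, hq⟩
    rw [quasiPeriod, Nat.lcm_eq_one_iff, Nat.lcm_eq_one_iff] at hq
    refine ⟨c 2 0, c 1 0, c 0 0, fun n hn => ?_⟩
    rw [hc.count n hn, eq_of_minPeriod_eq_one (hc.periodic 0) hq.1.1,
      eq_of_minPeriod_eq_one (hc.periodic 1) hq.1.2, eq_of_minPeriod_eq_one (hc.periodic 2) hq.2]
  · rintro ⟨a, b, c, h⟩
    refine ⟨fun i _ => ![c, b, a] i, ⟨fun i => ⟨1, one_pos, fun _ => rfl⟩, fun n hn => ?_⟩, ?_⟩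
    · simpa using h n hn
    · simp [quasiPeriod, minPeriod_const]

/-- The Ehrhart polynomial of a pseudo-integral polygon has constant term one, and its values at
negative integers count interior lattice points. -/
theorem IsPIP.reciprocity {P : Set (ℝ × ℝ)} (hP : IsPIP P) : ∃ a b : ℚ, b ≠ 0 ∧
    (boundaryCount P : ℚ) = 2 * b ∧ ∀ n : ℕ, 0 < n →
      (latticeCount (dilate n P) : ℚ) = a * n ^ 2 + b * n + 1 ∧
      (latticeCount (interior (dilate n P)) : ℚ) = a * n ^ 2 - b * n + 1 := by
  obtain ⟨⟨S, hS, rfl⟩, a, b, c, h⟩ := isPIP_iff.1 hP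
  change ∀ n : ℕ, 0 < n → (latticeCount (dilate n (hull S)) : ℚ) = _ at h
  change ∃ a b : ℚ, b ≠ 0 ∧ (boundaryCount (hull S) : ℚ) = 2 * b ∧ ∀ n : ℕ, 0 < n →
      (latticeCount (dilate n (hull S)) : ℚ) = a * n ^ 2 + b * n + 1 ∧
      (latticeCount (interior (dilate n (hull S))) : ℚ) = a * n ^ 2 - b * n + 1
  obtain ⟨E, hE, hE0, hEn⟩ := exists_ehrhart_reciprocity hS
  have hpoly := hE.eq_of_forall_pos (a := a) (b := b) (c := c) (fun n hn => by
    lift n to ℕ using hn.le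
    have hn' : 0 < n := by exact_mod_cast hn
    rw [(hEn n hn').1, h n hn']
    push_cast
    rfl)
  have hc : c = 1 := by
    have := hpoly 0
    rw [hE0] at this
    simpa using this.symm
  subst hc
  have hint : ∀ n : ℕ, 0 < n →
      (latticeCount (interior (dilate n (hull S))) : ℚ) = a * n ^ 2 - b * n + 1 := by
    intro n hn
    rw [← (hEn n hn).2, hpoly]
    push_cast
    ring
  refine ⟨a, b, ?_, ?_, fun n hn => ⟨h n hn, hint n hn⟩⟩
  · rintro rfl
    obtain ⟨n, hn, hlt⟩ := exists_latticeCount_interior_lt hS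
    have e1 := h n hn
    have e2 := hint n hn
    have : (latticeCount (interior (dilate n (hull S))) : ℚ)
      < latticeCount (dilate n (hull S)) := by exact_mod_cast hlt
    linarith
  · have e1 := h 1 one_pos
    have e2 := hint 1 one_pos
    have e3 := interiorCount_add_boundaryCount (isCompact_hull S)
    rw [dilate_one] at e1 e2
    rw [← e3, interiorCount] at e1
    push_cast at e1 e2
    linarith

theorem IsPIP.boundaryCount_ne_zero {P : Set (ℝ × ℝ)} (hP : IsPIP P) : boundaryCount P ≠ 0 := by
  obtain ⟨a, b, hb, h, -⟩ := hP.reciprocity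
  intro h0
  rw [h0] at h
  push_cast at h
  exact hb (by linarith)

/-- A pseudo-integral polygon without interior lattice points has at least three lattice points on
its boundary. -/
theorem IsPIP.three_le_boundaryCount {P : Set (ℝ × ℝ)} (hP : IsPIP P) (hI : interiorCount P = 0) :
    3 ≤ boundaryCount P := by
  obtain ⟨a, b, hb, h, hn⟩ := hP.reciprocity
  have h1 := (hn 1 one_pos).2
  -- With `a = b - 1` the interior of `3P` has `6 b - 8` lattice points. This is nonnegative, so `2
  -- b ≥ 8/3`.
  have h3 := (hn 3 (by norm_num)).2
  rw [dilate_one, show latticeCount (interior P) = 0 from hI] at h1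
  have h0 : (0 : ℚ) ≤ latticeCount (interior (dilate 3 P)) := Nat.cast_nonneg _
  push_cast at h1 h3
  have h4 : (2 : ℚ) < boundaryCount P := by linarith
  exact_mod_cast h4

/-! ### The kites and their interior lattice points. -/

/-- The vertices of the kite with diagonals on the coordinate axes that is cut out by
`x + q y ≤ 1`, `-L x + q K y ≤ K`, `K x - q y ≤ K` and `-L x - q y ≤ K`. -/
def kiteVertices (K L q : ℕ) : Finset (ℚ × ℚ) :=
  {(1, 0), (-((K : ℚ) / L), 0), (0, 1 / (q : ℚ)), (0, -((K : ℚ) / q))}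

variable {K L q : ℕ}

theorem not_collinear_kite (hK : 0 < K) (hq : 0 < q) :
    ¬ Collinear ℝ (ratPoint '' (kiteVertices K L q : Set (ℚ × ℚ))) := by
  have hmem : ∀ p ∈ kiteVertices K L q,
      ratPoint p ∈ ratPoint '' (kiteVertices K L q : Set (ℚ × ℚ)) := fun p hp => ⟨p, hp, rfl⟩
  rw [collinear_iff_of_mem (hmem (1, 0) (by simp [kiteVertices]))]
  rintro ⟨v, hv⟩
  obtain ⟨r, hr⟩ := hv _ (hmem (0, 1 / q) (by simp [kiteVertices]))
  obtain ⟨s, hs⟩ := hv _ (hmem (0, -(K / q)) (by simp [kiteVertices]))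
  have hK' : (0 : ℝ) < K := by exact_mod_cast hK
  have hq' : (0 : ℝ) < q := by exact_mod_cast hq
  simp only [ratPoint, Prod.ext_iff, vadd_eq_add, Prod.fst_add, Prod.snd_add, Prod.smul_fst,
    Prod.smul_snd, smul_eq_mul] at hr hs
  push_cast at hr hs
  have h1 : (r - s) * v.1 = 0 := by linarith [hr.1, hs.1]
  rcases mul_eq_zero.1 h1 with h | h
  · have h2 : r = s := by linarith
    rw [h2] at hr
    have : (0 : ℝ) < 1 / q := by positivity
    have : (0 : ℝ) < K / q := by positivity
    linarith [hr.2, hs.2]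
  · rw [h] at hr
    linarith [hr.1]

theorem mem_kite_iff (hK : 0 < K) (hL : 0 < L) (hq : 0 < q) (x y : ℝ) :
    (x, y) ∈ hull (kiteVertices K L q) ↔
      (x + q * y ≤ 1 ∧ -L * x + q * K * y ≤ K) ∧ K * x - q * y ≤ K ∧ -L * x - q * y ≤ K := by
  have hK' : (0 : ℝ) < K := by exact_mod_cast hK
  have hL' : (0 : ℝ) < L := by exact_mod_cast hL
  have hq' : (0 : ℝ) < q := by exact_mod_cast hq
  constructor
  · intro h
    have key : ∀ a b c : ℝ, a ≤ c → -a * K / L ≤ c → b / q ≤ c → -b * K / q ≤ c →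
        a * x + b * y ≤ c := by
      intro a b c h1 h2 h3 h4
      refine hull_subset_halfPlane (α := a) (β := b) (γ := c) (fun p hp => ?_) h
      simp only [kiteVertices, Finset.mem_insert, Finset.mem_singleton] at hp
      rcases hp with rfl | rfl | rfl | rfl <;> push_cast
      · linarith
      · calc _ = -a * K / L := by ring
          _ ≤ c := h2
      · calc _ = b / q := by ring
          _ ≤ c := h3
      · calc _ = -b * K / q := by ring
          _ ≤ c := h4
    refine ⟨⟨?_, ?_⟩, ?_, ?_⟩
    · have := key 1 q 1 le_rfl (by rw [div_le_iff₀ hL']; linarith) (by rw [div_le_iff₀ hq']; linarith)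
        (by rw [div_le_iff₀ hq']; nlinarith)
      linarith
    · have := key (-L) (q * K) K (by linarith) (by rw [div_le_iff₀ hL']; linarith)
        (by rw [div_le_iff₀ hq']; linarith) (by rw [div_le_iff₀ hq']; nlinarith [mul_pos hq' hK'])
      linarith
    · have := key K (-q) K le_rfl (by rw [div_le_iff₀ hL']; nlinarith)
        (by rw [div_le_iff₀ hq']; nlinarith) (by rw [div_le_iff₀ hq']; linarith)
      linarith
    · have := key (-L) (-q) K (by linarith) (by rw [div_le_iff₀ hL']; linarith)
        (by rw [div_le_iff₀ hq']; nlinarith) (by rw [div_le_iff₀ hq']; linarith)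
      linarith
  · rintro ⟨⟨h1, h2⟩, h3, h4⟩
    have hconv := convex_hull (kiteVertices K L q)
    have v1 : ((1, 0) : ℝ × ℝ) ∈ hull (kiteVertices K L q) := by
      simpa [ratPoint] using ratPoint_mem_hull (S := kiteVertices K L q) (p := (1, 0))
        (by simp [kiteVertices])
    have v2 : ((-(K / L), 0) : ℝ × ℝ) ∈ hull (kiteVertices K L q) := by
      simpa [ratPoint] using ratPoint_mem_hull (S := kiteVertices K L q) (p := (-(K / L), 0))
        (by simp [kiteVertices])
    have v3 : ((0, 1 / q) : ℝ × ℝ) ∈ hull (kiteVertices K L q) := by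
      simpa [ratPoint] using ratPoint_mem_hull (S := kiteVertices K L q) (p := (0, 1 / q))
        (by simp [kiteVertices])
    have v4 : ((0, -(K / q)) : ℝ × ℝ) ∈ hull (kiteVertices K L q) := by
      simpa [ratPoint] using ratPoint_mem_hull (S := kiteVertices K L q) (p := (0, -(K / q)))
        (by simp [kiteVertices])
    have v0 : ((0, 0) : ℝ × ℝ) ∈ hull (kiteVertices K L q) := by
      have hpos : (0 : ℝ) < K / L := by positivity
      convert hconv v1 v2 (a := (K / L) / (1 + K / L)) (b := 1 / (1 + K / L)) (by positivity)
        (by positivity) (by field_simp; ring) using 1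
      ext
      · simp only [Prod.fst_add, Prod.smul_fst, smul_eq_mul]
        field_simp
        ring
      · simp
    have comb : ∀ p r : ℝ × ℝ, p ∈ hull (kiteVertices K L q) → r ∈ hull (kiteVertices K L q) →
        ∀ s t : ℝ, 0 ≤ s → 0 ≤ t → s + t ≤ 1 → s • p + t • r ∈ hull (kiteVertices K L q) := by
      intro p r hp hr s t hs ht hst
      rcases (add_nonneg hs ht).eq_or_lt with h | h
      · have hs0 : s = 0 := by linarith
        have ht0 : t = 0 := by linarith
        rw [hs0, ht0, zero_smul, zero_smul, add_zero]
        exact v0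
      · have := hconv.smul_mem_of_zero_mem v0 (hconv hp hr (a := s / (s + t)) (b := t / (s + t))
          (by positivity) (by positivity) (by field_simp)) (t := s + t) ⟨h.le, hst⟩
        rwa [smul_add, smul_smul, smul_smul, mul_div_cancel₀ _ h.ne', mul_div_cancel₀ _ h.ne']
          at this
    -- In each closed quadrant the point is a nonnegative combination of the two vertices on its
    -- axes. The inequality of that quadrant says that the weights add up to at most one, and the
    -- origin takes up the rest.
    rcases le_total 0 x with hx | hx <;> rcases le_total 0 y with hy | hy
    · convert comb _ _ v1 v3 x (q * y) hx (by positivity) h1 using 1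
      ext <;> simp
      field_simp
    · convert comb _ _ v1 v4 x (-(q * y) / K) hx
        (div_nonneg (by nlinarith) hK'.le)
        (by rw [← sub_nonneg]; have : 1 - (x + -(q * y) / K) = (K - (K * x - q * y)) / K := by
              field_simp; ring
            rw [this]; exact div_nonneg (by linarith) hK'.le) using 1
      ext <;> simp
      field_simp
    · convert comb _ _ v2 v3 (-(L * x) / K) (q * y) (div_nonneg (by nlinarith) hK'.le)
        (by positivity)
        (by rw [← sub_nonneg]
            have : 1 - (-(L * x) / K + q * y) = (K - (-L * x + q * K * y)) / K := by
              field_simp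
            rw [this]; exact div_nonneg (by linarith) hK'.le) using 1
      ext <;> simp
      · field_simp
      · field_simp
    · convert comb _ _ v2 v4 (-(L * x) / K) (-(q * y) / K) (div_nonneg (by nlinarith) hK'.le)
        (div_nonneg (by nlinarith) hK'.le)
        (by rw [← sub_nonneg]
            have : 1 - (-(L * x) / K + -(q * y) / K) = (K - (-L * x - q * y)) / K := by
              field_simp; ring
            rw [this]; exact div_nonneg (by linarith) hK'.le) using 1
      ext <;> simp
      · field_simp
      · field_simp

/-- An interior point can be scaled by some `t > 1` without leaving `P`. As `c > 0`, a value of at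
least `c` would then exceed `c` after scaling. -/
theorem lt_of_mem_interior {P : Set (ℝ × ℝ)} {a b c : ℝ} (hc : 0 < c)
    (hP : ∀ x y : ℝ, (x, y) ∈ P → a * x + b * y ≤ c) {x y : ℝ} (h : (x, y) ∈ interior P) :
    a * x + b * y < c := by
  have hcont : Filter.Tendsto (fun t : ℝ => (t * x, t * y)) (nhds 1) (nhds (x, y)) := by
    have : Continuous fun t : ℝ => (t * x, t * y) := by fun_prop
    simpa using this.tendsto 1
  have hev := (hcont.eventually (mem_interior_iff_mem_nhds.1 h)).filter_mono
    (nhdsWithin_le_nhds (s := Set.Ioi 1))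
  obtain ⟨t, ht, ht1⟩ := (hev.and self_mem_nhdsWithin).exists
  have := hP _ _ ht
  have ht1' : 1 < t := ht1
  nlinarith

theorem mem_interior_kite_iff (hK : 0 < K) (hL : 0 < L) (hq : 0 < q) (x y : ℝ) :
    (x, y) ∈ interior (hull (kiteVertices K L q)) ↔
      (x + q * y < 1 ∧ -L * x + q * K * y < K) ∧ K * x - q * y < K ∧ -L * x - q * y < K := by
  have hK' : (0 : ℝ) < K := by exact_mod_cast hK
  constructor
  · intro h
    refine ⟨⟨?_, ?_⟩, ?_, ?_⟩
    · have := lt_of_mem_interior (a := 1) (b := q) one_pos (fun x y h => by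
        have := ((mem_kite_iff hK hL hq x y).1 h).1.1; linarith) h
      linarith
    · exact lt_of_mem_interior hK' (fun x y h => ((mem_kite_iff hK hL hq x y).1 h).1.2) h
    · have := lt_of_mem_interior (a := K) (b := -q) hK' (fun x y h => by
        have := ((mem_kite_iff hK hL hq x y).1 h).2.1; linarith) h
      linarith
    · have := lt_of_mem_interior (a := -L) (b := -q) hK' (fun x y h => by
        have := ((mem_kite_iff hK hL hq x y).1 h).2.2; linarith) h
      linarith
  · intro h
    have hopen : IsOpen {z : ℝ × ℝ | (z.1 + q * z.2 < 1 ∧ -L * z.1 + q * K * z.2 < K) ∧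
        K * z.1 - q * z.2 < K ∧ -L * z.1 - q * z.2 < K} := by
      refine ((isOpen_lt ?_ ?_).and (isOpen_lt ?_ ?_)).and
        ((isOpen_lt ?_ ?_).and (isOpen_lt ?_ ?_)) <;> fun_prop
    refine interior_maximal (fun z hz => ?_) hopen h
    exact (mem_kite_iff hK hL hq z.1 z.2).2 ⟨⟨hz.1.1.le, hz.1.2.le⟩, hz.2.1.le, hz.2.2.le⟩

/-- The vertical diagonal runs from `-(J + 1/q)` to `1/q`. Off it, `x ≥ 1` forces `y < 0` by the
first inequality, against the third. Since `L ≥ K`, `x ≤ -1` forces `y > 0` by the fourth, against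
the second. -/
theorem interiorCount_kite {J : ℕ} (hKL : q * J + 1 ≤ L) (hq : 2 ≤ q) :
    interiorCount (hull (kiteVertices (q * J + 1) L q)) = J + 1 := by
  rw [interiorCount, latticeCount_eq_sum {0} (fun _ => Finset.Icc (-J) 0)]
  · simp
    omega
  · intro x y
    rw [mem_interior_kite_iff (by omega) (by omega) (by omega)]
    have hq' : (2 : ℤ) ≤ q := by exact_mod_cast hq
    have hL' : (q * J + 1 : ℤ) ≤ L := by exact_mod_cast hKL
    have hJ' : (0 : ℤ) ≤ J := Int.natCast_nonneg J
    have hcast : ((x : ℝ) + q * y < 1 ∧ -L * (x : ℝ) + q * (q * J + 1 : ℕ) * y < (q * J + 1 : ℕ)) ∧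
        (q * J + 1 : ℕ) * (x : ℝ) - q * y < (q * J + 1 : ℕ) ∧
        -L * (x : ℝ) - q * y < (q * J + 1 : ℕ) ↔
        (x + q * y < 1 ∧ -L * x + q * (q * J + 1) * y < (q * J + 1 : ℤ)) ∧
        (q * J + 1) * x - q * y < (q * J + 1 : ℤ) ∧ -L * x - q * y < (q * J + 1 : ℤ) := by
      norm_cast
    rw [hcast, Finset.mem_singleton, Finset.mem_Icc]
    have hqJ : 0 ≤ (q : ℤ) * J := by positivity
    constructor
    · rintro ⟨⟨h1, h2⟩, h3, h4⟩
      have hx : x = 0 := by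
        rcases lt_trichotomy x 0 with h | h | h
        · have hL1 : (q * J + 1 : ℤ) ≤ -L * x := by nlinarith
          have hy : 0 < y := by
            by_contra! hy
            nlinarith
          have : 0 < (q : ℤ) * (q * J + 1) * y := by positivity
          linarith
        · exact h
        · have hy : y < 0 := by
            by_contra! hy
            nlinarith
          nlinarith
      subst hx
      refine ⟨rfl, ?_, ?_⟩
      · by_contra! hy
        nlinarith
      · by_contra! hy
        nlinarith
    · rintro ⟨rfl, h1, h2⟩
      refine ⟨⟨?_, ?_⟩, ?_, ?_⟩
      · nlinarith
      · have : (q : ℤ) * (q * J + 1) * y ≤ 0 := mul_nonpos_of_nonneg_of_nonpos (by positivity) h2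
        linarith
      · nlinarith
      · nlinarith

/-! ### Counting lattice points of dilated kites by rows. -/

/-- The number of lattice points of the `n`-th dilate of the kite, row by row. -/
def kiteCount (K L q n : ℕ) : ℕ :=
  ∑ i ∈ Finset.range (n / q + 1), ((n % q + q * i) + K * (n % q + q * i) / L + 1) +
    ∑ i ∈ Finset.range (K * n / q), ((K * n % q + q * i) / K + (K * n % q + q * i) / L + 1)

theorem latticeCount_eq_sum_rows {Q : Set (ℝ × ℝ)} (s : Finset ℤ) (t : ℤ → Finset ℤ)
    (h : ∀ x y : ℤ, ((x : ℝ), (y : ℝ)) ∈ Q ↔ y ∈ s ∧ x ∈ t y) :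
    latticeCount Q = ∑ y ∈ s, (t y).card := by
  have hinj : Function.Injective fun z : (_ : ℤ) × ℤ => ((z.2 : ℝ), (z.1 : ℝ)) := by
    rintro ⟨x, y⟩ ⟨x', y'⟩ h
    simpa [and_comm] using h
  have : Q ∩ lattice = (fun z : (_ : ℤ) × ℤ => ((z.2 : ℝ), (z.1 : ℝ))) '' (s.sigma t : Set _) := by
    ext z
    constructor
    · rintro ⟨hz, ⟨x, y⟩, rfl⟩
      exact ⟨⟨y, x⟩, by simpa using (h x y).1 hz, rfl⟩
    · rintro ⟨⟨y, x⟩, hxy, rfl⟩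
      exact ⟨(h x y).2 (by simpa using hxy), ⟨(x, y), rfl⟩⟩
  rw [latticeCount, this, Set.ncard_image_of_injective _ hinj, Set.ncard_coe_finset,
    Finset.card_sigma]

theorem mem_dilate_kite_iff (hK : 0 < K) (hL : 0 < L) (hq : 0 < q) {n : ℕ} (hn : 0 < n) (x y : ℤ) :
    ((x : ℝ), (y : ℝ)) ∈ dilate n (hull (kiteVertices K L q)) ↔
      (x + q * y ≤ n ∧ -L * x + q * K * y ≤ K * n) ∧
        K * x - q * y ≤ K * n ∧ -L * x - q * y ≤ K * n := by
  have hn' : (0 : ℝ) < n := by exact_mod_cast hn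
  rw [mem_dilate_iff hn, mem_kite_iff hK hL hq]
  have e1 : (x : ℝ) / n + q * (y / n) = (x + q * y) / n := by ring
  have e2 : -L * ((x : ℝ) / n) + q * K * (y / n) = (-L * x + q * K * y) / n := by ring
  have e3 : K * ((x : ℝ) / n) - q * (y / n) = (K * x - q * y) / n := by ring
  have e4 : -L * ((x : ℝ) / n) - q * (y / n) = (-L * x - q * y) / n := by ring
  rw [e1, e2, e3, e4, div_le_iff₀ hn', div_le_iff₀ hn', div_le_iff₀ hn', div_le_iff₀ hn', one_mul]
  norm_cast

theorem latticeCount_dilate_kite (hK : 0 < K) (hL : 0 < L) (hq : 0 < q) {n : ℕ} (hn : 0 < n) :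
    latticeCount (dilate n (hull (kiteVertices K L q))) = kiteCount K L q n := by
  have hK' : (0 : ℤ) < K := by exact_mod_cast hK
  have hL' : (0 : ℤ) < L := by exact_mod_cast hL
  have hq' : (0 : ℤ) < q := by exact_mod_cast hq
  -- For `y ≥ 0` the first two inequalities imply the others, and for `y < 0` the last two do. So
  -- each row is an explicit interval.
  rw [latticeCount_eq_sum_rows (Finset.Ico (-(K * n / q : ℕ) : ℤ) 0 ∪ Finset.Icc 0 (n / q : ℕ))
    (fun y => if 0 ≤ y then Finset.Icc (-(K * (n - q * y) / L)) (n - q * y)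
      else Finset.Icc (-((K * n + q * y) / L)) ((K * n + q * y) / K))]
  · rw [Finset.sum_union (by rw [Finset.disjoint_left]; intro y; simp; omega), add_comm, kiteCount]
    congr 1
    · symm
      have hdm : ((n % q : ℕ) : ℤ) + q * (n / q : ℕ) = n := by exact_mod_cast Nat.mod_add_div n q
      refine Finset.sum_nbij' (fun i => ((n / q : ℕ) : ℤ) - i) (fun y => ((n / q : ℕ) - y).toNat)
        ?_ ?_ ?_ ?_ ?_
      · intro i; simp only [Finset.mem_range, Finset.mem_Icc]; omega
      · intro y; simp only [Finset.mem_range, Finset.mem_Icc]; omega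
      · intro i; simp only [Finset.mem_range]; omega
      · intro y; simp only [Finset.mem_Icc]; omega
      · intro i hi
        rw [Finset.mem_range] at hi
        have hy : (n : ℤ) - q * ((n / q : ℕ) - i) = ((n % q + q * i : ℕ) : ℤ) := by
          push_cast at hdm ⊢
          linear_combination -hdm
        rw [if_pos (by omega), hy, Int.card_Icc]
        have : (K : ℤ) * ((n % q + q * i : ℕ) : ℤ) / L = ((K * (n % q + q * i) / L : ℕ) : ℤ) := by
          push_cast; rfl
        rw [this]
        generalize K * (n % q + q * i) / L = a
        generalize n % q + q * i = r
        omega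
    · symm
      have hdm : ((K * n % q : ℕ) : ℤ) + q * (K * n / q : ℕ) = K * n := by
        exact_mod_cast Nat.mod_add_div (K * n) q
      refine Finset.sum_nbij' (fun i => i - ((K * n / q : ℕ) : ℤ))
        (fun y => (y + (K * n / q : ℕ)).toNat) ?_ ?_ ?_ ?_ ?_
      · intro i; simp only [Finset.mem_range, Finset.mem_Ico]; omega
      · intro y; simp only [Finset.mem_range, Finset.mem_Ico]; omega
      · intro i; simp only [Finset.mem_range]; omega
      · intro y; simp only [Finset.mem_Ico]; omega
      · intro i hi
        rw [Finset.mem_range] at hi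
        have hy : (K : ℤ) * n + q * (i - (K * n / q : ℕ)) = ((K * n % q + q * i : ℕ) : ℤ) := by
          push_cast at hdm ⊢
          linear_combination -hdm
        rw [if_neg (by omega), hy, Int.card_Icc, ← Int.natCast_ediv, ← Int.natCast_ediv]
        generalize (K * n % q + q * i) / K = a
        generalize (K * n % q + q * i) / L = b
        omega
  · intro x y
    rw [mem_dilate_kite_iff hK hL hq hn, Finset.mem_union, Finset.mem_Ico, Finset.mem_Icc]
    push_cast
    have hN : y ≤ (n : ℤ) / q ↔ q * y ≤ n := by rw [Int.le_ediv_iff_mul_le hq', mul_comm]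
    have hM : -((K : ℤ) * n / q) ≤ y ↔ 0 ≤ K * n + q * y := by
      rw [neg_le, Int.le_ediv_iff_mul_le hq']
      constructor <;> intro h <;> linarith
    rw [hN, hM]
    split_ifs with hy
    · have h1 : -(K * (n - q * y) / L) ≤ x ↔ -L * x ≤ K * (n - q * y) := by
        rw [neg_le, Int.le_ediv_iff_mul_le hL']
        constructor <;> intro h <;> linarith
      rw [Finset.mem_Icc, h1]
      constructor
      · rintro ⟨⟨a, b⟩, c, d⟩
        refine ⟨Or.inr ⟨hy, ?_⟩, by linarith, by linarith⟩
        by_contra! h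
        nlinarith
      · rintro ⟨-, b, c⟩
        have : 0 ≤ q * y := by positivity
        have : 0 ≤ K * (q * y) := by positivity
        refine ⟨⟨by linarith, by linarith⟩, ?_, by linarith⟩
        have := mul_le_mul_of_nonneg_left c hK'.le
        linarith
    · have h1 : -((K * n + q * y) / L) ≤ x ↔ -L * x ≤ K * n + q * y := by
        rw [neg_le, Int.le_ediv_iff_mul_le hL']
        constructor <;> intro h <;> linarith
      have h2 : x ≤ (K * n + q * y) / K ↔ K * x ≤ K * n + q * y := by
        rw [Int.le_ediv_iff_mul_le hK', mul_comm]
      rw [Finset.mem_Icc, h1, h2]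
      push Not at hy
      constructor
      · rintro ⟨⟨a, b⟩, c, d⟩
        refine ⟨Or.inl ⟨?_, hy⟩, by linarith, by linarith⟩
        by_contra! h
        nlinarith
      · rintro ⟨-, b, c⟩
        have : q * y ≤ 0 := by nlinarith
        have : K * (q * y) ≤ 0 := mul_nonpos_of_nonneg_of_nonpos hK'.le this
        refine ⟨⟨?_, by linarith⟩, by linarith, by linarith⟩
        refine le_of_mul_le_mul_left ?_ hK'
        linarith

/-- Rows are indexed from the top and bottom vertices towards the axis, so their lengths depend on
`n` only through `n % q` and `K * n % q`. Passing to `n + q` keeps all of them and inserts the rows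
`y = -K, …, 0`. -/
theorem kiteCount_add (hq : 0 < q) (n : ℕ) : kiteCount K L q (n + q) = kiteCount K L q n
    + ((n + q) + K * (n + q) / L + 1)
    + ∑ i ∈ Finset.range K, ((K * n + q * i) / K + (K * n + q * i) / L + 1) := by
  have h1 : n % q + q * (n / q + 1) = n + q := by
    have := Nat.mod_add_div n q
    rw [mul_add]
    omega
  have h2 : K * (n + q) / q = K * n / q + K := by rw [mul_add, Nat.add_mul_div_right _ _ hq]
  have h3 : ∀ i, K * n % q + q * (K * n / q + i) = K * n + q * i := by
    intro i
    have := Nat.mod_add_div (K * n) q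
    rw [mul_add]
    omega
  have h4 : K * (n + q) % q = K * n % q := by rw [mul_add, Nat.add_mul_mod_self_right]
  rw [kiteCount, kiteCount, Nat.add_mod_right, Nat.add_div_right _ hq,
    Finset.sum_range_succ _ (n / q + 1), h1, h2, h4, Finset.sum_range_add _ (K * n / q) K]
  simp only [h3]
  ring

/-! ### Closed forms for the two families of kites. -/

theorem sum_range_steps {f : ℕ → ℕ} {a b c : ℕ} (h0 : ∀ i < a, f i = 0)
    (h1 : ∀ i < b, f (a + i) = 1) (h2 : ∀ i < c, f (a + b + i) = 2) :
    ∑ i ∈ Finset.range (a + b + c), f i = b + 2 * c := by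
  rw [Finset.sum_range_add, Finset.sum_range_add,
    Finset.sum_congr rfl fun i hi => h0 i (Finset.mem_range.1 hi),
    Finset.sum_congr rfl fun i hi => h1 i (Finset.mem_range.1 hi),
    Finset.sum_congr rfl fun i hi => h2 i (Finset.mem_range.1 hi)]
  simp
  ring

/-- Hermite's identity for `⌊(x + 3 i) / N⌋` with `N` congruent to two modulo three. -/
theorem sum_add_three_mul_div (J x : ℕ) :
    ∑ i ∈ Finset.range (3 * J + 2), (x + 3 * i) / (3 * J + 2) = x + 3 * J + 1 := by
  induction x using Nat.strong_induction_on with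
  | _ x ih =>
    rcases lt_or_ge x 3 with hx | hx
    · have div_eq : ∀ k m, k * (3 * J + 2) ≤ m → m < (k + 1) * (3 * J + 2) →
          m / (3 * J + 2) = k := fun k m h1 h2 => Nat.div_eq_of_lt_le h1 h2
      interval_cases x
      · rw [show 3 * J + 2 = (J + 1) + (J + 1) + J by ring]
        rw [sum_range_steps]
        · ring
        all_goals
          intro i hi
          rw [show J + 1 + (J + 1) + J = 3 * J + 2 by ring]
          exact div_eq _ _ (by omega) (by omega)
      · rw [show 3 * J + 2 = (J + 1) + J + (J + 1) by ring]
        rw [sum_range_steps]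
        · ring
        all_goals
          intro i hi
          rw [show J + 1 + J + (J + 1) = 3 * J + 2 by ring]
          exact div_eq _ _ (by omega) (by omega)
      · rw [show 3 * J + 2 = J + (J + 1) + (J + 1) by ring]
        rw [sum_range_steps]
        · ring
        all_goals
          intro i hi
          rw [show J + (J + 1) + (J + 1) = 3 * J + 2 by ring]
          exact div_eq _ _ (by omega) (by omega)
    · obtain ⟨y, rfl⟩ := Nat.exists_eq_add_of_le' hx
      have h := ih y (by omega)
      -- Adding `3` to `y` shifts the index by one: the term `y / N` drops out and `(y + 3 N) / N =
      -- y / N + 3` comes in, where `N = 3 J + 2`.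
      have e1 := Finset.sum_range_succ (fun i => (y + 3 * i) / (3 * J + 2)) (3 * J + 2)
      have e2 := Finset.sum_range_succ' (fun i => (y + 3 * i) / (3 * J + 2)) (3 * J + 2)
      rw [Nat.add_mul_div_right _ _ (by omega)] at e1
      simp only [mul_zero, add_zero] at e2
      have e3 : ∑ i ∈ Finset.range (3 * J + 2), (y + 3 + 3 * i) / (3 * J + 2)
          = ∑ i ∈ Finset.range (3 * J + 2), (y + 3 * (i + 1)) / (3 * J + 2) :=
        Finset.sum_congr rfl fun i _ => by congr 1; ring
      omega

/-- The increment from `n` to `n + 3` is affine in `n`, the same formula for every residue. The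
values at `0`, `1`, `2` then place all three residue classes on one polynomial. -/
theorem kiteCount_three (J n : ℕ) :
    2 * kiteCount (3 * J + 1) (3 * J + 2) 3 n = (2 * J + 1) * n ^ 2 + n + 2 := by
  induction n using Nat.strong_induction_on with
  | _ n ih =>
    have divK : ∀ k m, k * (3 * J + 1) ≤ m → m < (k + 1) * (3 * J + 1) →
      m / (3 * J + 1) = k := fun k m h1 h2 => Nat.div_eq_of_lt_le h1 h2
    have divL : ∀ k m, k * (3 * J + 2) ≤ m → m < (k + 1) * (3 * J + 2) →
      m / (3 * J + 2) = k := fun k m h1 h2 => Nat.div_eq_of_lt_le h1 h2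
    rcases lt_or_ge n 3 with hn | hn
    · interval_cases n
      · simp [kiteCount]
      · have hs : ∑ i ∈ Finset.range J,
            ((1 + 3 * i) / (3 * J + 1) + (1 + 3 * i) / (3 * J + 2) + 1) = J := by
          rw [Finset.sum_congr rfl (g := fun _ => 1) fun i hi => by
            rw [Finset.mem_range] at hi
            rw [divK 0 _ (by omega) (by omega), divL 0 _ (by omega) (by omega)]]
          simp
        rw [kiteCount, mul_one, show (3 * J + 1) / 3 = J by omega,
          show (3 * J + 1) % 3 = 1 by omega, hs]
        simp [divL 0 (3 * J + 1) (by omega) (by omega)]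
        ring
      · have hs : ∑ i ∈ Finset.range (J + J),
            ((2 + 3 * i) / (3 * J + 1) + (2 + 3 * i) / (3 * J + 2) + 1) = 4 * J := by
          have h0 : ∀ i ∈ Finset.range J,
              (2 + 3 * i) / (3 * J + 1) + (2 + 3 * i) / (3 * J + 2) + 1 = 1 := fun i hi => by
            rw [Finset.mem_range] at hi
            rw [divK 0 _ (by omega) (by omega), divL 0 _ (by omega) (by omega)]
          have h1 : ∀ i ∈ Finset.range J, (2 + 3 * (J + i)) / (3 * J + 1)
              + (2 + 3 * (J + i)) / (3 * J + 2) + 1 = 3 := fun i hi => by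
            rw [Finset.mem_range] at hi
            rw [divK 1 _ (by omega) (by omega), divL 1 _ (by omega) (by omega)]
          rw [Finset.sum_range_add, Finset.sum_congr rfl h0, Finset.sum_congr rfl h1]
          simp
          ring
        rw [kiteCount, show (3 * J + 1) * 2 / 3 = J + J by omega,
          show (3 * J + 1) * 2 % 3 = 2 by omega, hs]
        simp [divL 1 ((3 * J + 1) * 2) (by omega) (by omega)]
        ring
    · obtain ⟨m, rfl⟩ := Nat.exists_eq_add_of_le' hn
      have h := ih m (by omega)
      -- The `K` new rows below the axis give only `K = L - 1` terms of the Hermite sum modulo `L`.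
      -- The missing term `i = K` is `K (m + 3) / L`, the left part of the new row `y = 0`.
      have hH := sum_add_three_mul_div J ((3 * J + 1) * m)
      rw [show 3 * J + 2 = 3 * J + 1 + 1 by ring, Finset.sum_range_succ,
        show 3 * J + 1 + 1 = 3 * J + 2 by ring] at hH
      have hK : ∑ i ∈ Finset.range (3 * J + 1), ((3 * J + 1) * m + 3 * i) / (3 * J + 1)
          = (3 * J + 1) * m + 3 * J := by
        have e : ∀ i, ((3 * J + 1) * m + 3 * i) / (3 * J + 1) = m + 3 * i / (3 * J + 1) := by
          intro i
          rw [Nat.mul_add_div (by omega)]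
        simp only [e, Finset.sum_add_distrib]
        have : ∑ i ∈ Finset.range (3 * J + 1), 3 * i / (3 * J + 1) = J + 2 * J := by
          have := sum_range_steps (f := fun i => 3 * i / (3 * J + 1)) (a := J + 1) (b := J) (c := J)
            (fun i hi => divK 0 _ (by omega) (by omega))
            (fun i hi => divK 1 _ (by omega) (by omega))
            (fun i hi => divK 2 _ (by omega) (by omega))
          rwa [show J + 1 + J + J = 3 * J + 1 by ring] at this
        rw [this]
        simp
        ring
      rw [kiteCount_add (by norm_num), Finset.sum_add_distrib, Finset.sum_add_distrib, hK]
      rw [show (3 * J + 1) * m + 3 * (3 * J + 1) = (3 * J + 1) * (m + 3) by ring] at hH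
      simp only [Finset.sum_const, Finset.card_range, smul_eq_mul, mul_one]
      nlinarith

/-- Here `K = L`, so the kite is symmetric about the vertical axis and one floor sum serves both
sides. -/
theorem kiteCount_two (J n : ℕ) :
    kiteCount (2 * J + 1) (2 * J + 1) 2 n = (J + 1) * n ^ 2 + n + 1 := by
  induction n using Nat.strong_induction_on with
  | _ n ih =>
    have divK : ∀ k m, k * (2 * J + 1) ≤ m → m < (k + 1) * (2 * J + 1) →
      m / (2 * J + 1) = k := fun k m h1 h2 => Nat.div_eq_of_lt_le h1 h2
    rcases lt_or_ge n 2 with hn | hn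
    · interval_cases n
      · simp [kiteCount]
      · have hs : ∑ i ∈ Finset.range J,
            ((1 + 2 * i) / (2 * J + 1) + (1 + 2 * i) / (2 * J + 1) + 1) = J := by
          rw [Finset.sum_congr rfl (g := fun _ => 1) fun i hi => by
            rw [Finset.mem_range] at hi
            rw [divK 0 _ (by omega) (by omega)]]
          simp
        rw [kiteCount, mul_one, show (2 * J + 1) / 2 = J by omega,
          show (2 * J + 1) % 2 = 1 by omega, hs]
        simp
        ring
    · obtain ⟨m, rfl⟩ := Nat.exists_eq_add_of_le' hn
      have h := ih m (by omega)
      have hK : ∑ i ∈ Finset.range (2 * J + 1), ((2 * J + 1) * m + 2 * i) / (2 * J + 1)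
          = (2 * J + 1) * m + J := by
        have e : ∀ i, ((2 * J + 1) * m + 2 * i) / (2 * J + 1) = m + 2 * i / (2 * J + 1) := by
          intro i
          rw [Nat.mul_add_div (by omega)]
        simp only [e, Finset.sum_add_distrib]
        have : ∑ i ∈ Finset.range (2 * J + 1), 2 * i / (2 * J + 1) = J + 2 * 0 := by
          have := sum_range_steps (f := fun i => 2 * i / (2 * J + 1)) (a := J + 1) (b := J) (c := 0)
            (fun i hi => divK 0 _ (by omega) (by omega))
            (fun i hi => divK 1 _ (by omega) (by omega))
            (fun i hi => by omega)
          rwa [show J + 1 + J + 0 = 2 * J + 1 by ring] at this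
        rw [this]
        simp
      rw [kiteCount_add (by norm_num), Finset.sum_add_distrib, Finset.sum_add_distrib, hK, h,
        Nat.mul_div_cancel_left _ (by omega)]
      simp only [Finset.sum_const, Finset.card_range, smul_eq_mul, mul_one]
      ring

theorem isPIP_kite_of_kiteCount (hK : 0 < K) (hL : 0 < L) (hq : 0 < q) {a b c : ℚ}
    (h : ∀ n : ℕ, (kiteCount K L q n : ℚ) = a * n ^ 2 + b * n + c) :
    IsPIP (hull (kiteVertices K L q)) :=
  isPIP_iff.2 ⟨⟨_, not_collinear_kite hK hq, rfl⟩, a, b, c, fun n hn => by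
    rw [latticeCount_dilate_kite hK hL hq hn, h]⟩

theorem interiorCount_add_boundaryCount_kite (hK : 0 < K) (hL : 0 < L) (hq : 0 < q) :
    interiorCount (hull (kiteVertices K L q)) + boundaryCount (hull (kiteVertices K L q))
      = kiteCount K L q 1 := by
  rw [interiorCount_add_boundaryCount (isCompact_hull _),
    ← latticeCount_dilate_kite hK hL hq one_pos, dilate_one]

/-- With `L = K + 1` the left vertex is not a lattice point, and only `(1, 0)` remains on the
boundary. -/
theorem exists_isPIP_boundaryCount_one (J : ℕ) :
    ∃ P, IsPIP P ∧ interiorCount P = J + 1 ∧ boundaryCount P = 1 := by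
  have hI := interiorCount_kite (J := J) (L := 3 * J + 2) (q := 3) (by omega) (by norm_num)
  refine ⟨hull (kiteVertices (3 * J + 1) (3 * J + 2) 3), ?_, hI, ?_⟩
  · refine isPIP_kite_of_kiteCount (a := (2 * J + 1) / 2) (b := 1 / 2) (c := 1) (by omega)
      (by omega) (by omega) fun n => ?_
    have : (2 * kiteCount (3 * J + 1) (3 * J + 2) 3 n : ℚ) = (2 * J + 1) * n ^ 2 + n + 2 := by
      exact_mod_cast kiteCount_three J n
    linarith
  · have h1 := interiorCount_add_boundaryCount_kite (K := 3 * J + 1) (L := 3 * J + 2) (q := 3)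
      (by omega) (by omega) (by omega)
    have h2 := kiteCount_three J 1
    rw [hI] at h1
    omega

/-- With `L = K` the boundary lattice points are `(1, 0)` and `(-1, 0)`. -/
theorem exists_isPIP_boundaryCount_two (J : ℕ) :
    ∃ P, IsPIP P ∧ interiorCount P = J + 1 ∧ boundaryCount P = 2 := by
  have hI := interiorCount_kite (J := J) (L := 2 * J + 1) (q := 2) (by omega) (by norm_num)
  refine ⟨hull (kiteVertices (2 * J + 1) (2 * J + 1) 2), ?_, hI, ?_⟩
  · refine isPIP_kite_of_kiteCount (a := J + 1) (b := 1) (c := 1) (by omega)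
      (by omega) (by omega) fun n => ?_
    have : (kiteCount (2 * J + 1) (2 * J + 1) 2 n : ℚ) = (J + 1) * n ^ 2 + n + 1 := by
      exact_mod_cast kiteCount_two J n
    linarith
  · have h1 := interiorCount_add_boundaryCount_kite (K := 2 * J + 1) (L := 2 * J + 1) (q := 2)
      (by omega) (by omega) (by omega)
    have h2 := kiteCount_two J 1
    rw [hI] at h1
    omega

end EhrhartPIP

theorem mainTheorem1 :
    (¬ ∃ P : Set (ℝ × ℝ), EhrhartPIP.IsPIP P ∧
      (EhrhartPIP.boundaryCount P = 0 ∨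
        (EhrhartPIP.interiorCount P, EhrhartPIP.boundaryCount P) ∈
          ({(0, 1), (0, 2)} : Set (ℕ × ℕ)))) ∧
    (∀ I b : ℕ, 1 ≤ I → b ∈ ({1, 2} : Set ℕ) →
      ∃ P : Set (ℝ × ℝ), EhrhartPIP.IsPIP P ∧
        (EhrhartPIP.interiorCount P, EhrhartPIP.boundaryCount P) = (I, b)) := by
  constructor
  · rintro ⟨P, hP, h | h⟩
    · exact hP.boundaryCount_ne_zero h
    · simp only [Set.mem_insert_iff, Set.mem_singleton_iff, Prod.mk.injEq] at h
      have := hP.three_le_boundaryCount (by omega)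
      omega
  · intro I b hI hb
    obtain ⟨J, rfl⟩ := Nat.exists_eq_add_of_le' hI
    rcases hb with rfl | rfl
    · obtain ⟨P, hP, h1, h2⟩ := EhrhartPIP.exists_isPIP_boundaryCount_one J
      exact ⟨P, hP, by rw [h1, h2]⟩
    · obtain ⟨P, hP, h1, h2⟩ := EhrhartPIP.exists_isPIP_boundaryCount_two J
      exact ⟨P, hP, by rw [h1, h2]⟩
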